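/- **Setting.** Let $\mathbb R^{1,1}$ be $\mathbb R^2$ with coordinates $(x^0,x^1)$ and metric $g=-(dx^0)^2+(dx^1)^2$. A causal curve is a $C^1$ curve $\gamma:[0,T]\to\mathbb R^{1,1}$ with $\dot\gamma_0>0$ and $g(\dot\gamma,\dot\gamma)\le 0$ throughout (one-point curves, $T=0$, are allowed), its proper time is $l(\gamma)=\int_0^T\sqrt{-g(\dot\gamma,\dot\gamma)}\,dt$, and $p\preceq q$ means that there is a causal curve from $p$ to $q$. Let $\mathcal C_{\mathcal M}$ be the set of smooth real functions on $\mathbb R^{1,1}$ that are bounded together with all their derivatives and non-decreasing along causal curves, and let $\widetilde{\mathcal A}$ be the algebra of functions $\mathbf a:\mathbb R^{1,1}\to M_2(\mathbb C)$ whose diagonal entries lie in $\mathrm{span}_{\mathbb C}(\mathcal C_{\mathcal M})$ and whose off-diagonal entries are Schwartz functions. On $\mathcal H=L^2(\mathbb R^{1,1})\otimes\mathbb C^2\otimes\mathbb C^2$ put, for $d_1,d_2\in\mathbb R$, $$D=-i\gamma^\mu\partial_\mu\otimes 1+\gamma^0\gamma^1\otimes\mathrm{diag}(d_1,d_2),\qquad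 \mathcal J=i\gamma^0\otimes 1,\qquad \gamma^0=\begin{pmatrix}0&i\\ i&0\end{pmatrix},\quad \gamma^1=\begin{pmatrix}0&-i\\ i&0\end{pmatrix},$$ and let $\mathbf a\in\widetilde{\mathcal A}$ act by $1\otimes\mathbf a(x)$. Let $\mathcal C$ be the set of Hermitian $\mathbf a\in\widetilde{\mathcal A}$ with $\langle\phi,\mathcal J[D,\mathbf a]\phi\rangle\le 0$ for all $\phi\in\mathcal H$, where $[D,\mathbf a]$ denotes the bounded extension of the commutator. For states $\omega,\eta$ of $\widetilde{\mathcal A}$ write $\omega\preceq\eta$ if $\omega(\mathbf a)\le\eta(\mathbf a)$ for all $\mathbf a\in\mathcal C$. For $p\in\mathbb R^{1,1}$ and a density matrix $\rho\in M_2(\mathbb C)$ let $\omega_{p,\rho}(\mathbf a)=\mathrm{Tr}(\rho\,\mathbf a(p))$. **Theorem.** (1) Let $p,q\in\mathbb R^{1,1}$ and let $\rho=\tfrac12(1+\vec r\cdot\vec\sigma)$, $\sigma=\tfrac12(1+\vec s\cdot\vec\sigma)$ be density matrices with Bloch vectors $\vec r,\vec s$ in the closed unit ball of $\mathbb R^3$,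 where $\vec\sigma$ is the vector of Pauli matrices. Write $r_x+ir_y=re^{i\theta_r}$ and $s_x+is_y=se^{i\theta_s}$ with $r,s\ge 0$ and $\theta_r,\theta_s\in\mathbb R$. Then $\omega_{p,\rho}\preceq\omega_{q,\sigma}$ if and only if * $p\preceq q$ in $\mathbb R^{1,1}$; * $r_z=s_z=:z$; * there is a causal curve $\gamma$ from $p$ to $q$ with $$l(\gamma)\,|d_1-d_2|\ \ge\ \sup_{\theta\in\mathbb R}\left|\arccos\!\Big(\tfrac{s}{\sqrt{1-z^2}}\cos(\theta_s+\theta)\Big)-\arccos\!\Big(\tfrac{r}{\sqrt{1-z^2}}\cos(\theta_r+\theta)\Big)\right|,$$ where for $z=\pm1$ (so that $r=s=0$) both quotients are read as $0$. (2) Consequently, paths through mixed states do not shorten the proper time needed: let $\gamma:[0,T]\to\mathbb R^{1,1}$ be a causal curve and let $t\mapsto\rho_t$ be a continuous family of density matrices, $t\in[0,T]$, such that $\omega_{\gamma(t),\rho_t}\preceq\omega_{\gamma(t'),\rho_{t'}}$ whenever $t\le t'$. If $\rho_0$ and $\rho_T$ are pure (of the form $\xi\xi^*$), then along the same curve $\gamma$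 there is a continuous family of pure density matrices $\rho'_t$ with $\rho'_0=\rho_0$, $\rho'_T=\rho_T$ and $\omega_{\gamma(t),\rho'_t}\preceq\omega_{\gamma(t'),\rho'_{t'}}$ whenever $t\le t'$. -/

import Mathlib

open scoped ContDiff ComplexOrder Kronecker Matrix SchwartzMap
open MeasureTheory

noncomputable section

namespace AlmostCommutative

/-! ### Two-dimensional Minkowski space-time -/

/-- The space `ℝ^{1,1}`; a point is `(x⁰, x¹)` with `x⁰` the time coordinate. -/
abbrev Minkowski : Type := ℝ × ℝ

/-- The flat metric of signature `(-,+)`. -/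
def metric (v w : Minkowski) : ℝ := -(v.1 * w.1) + v.2 * w.2

/-- Nonzero future directed causal (timelike or null) vectors. -/
def IsFutureCausal (v : Minkowski) : Prop := metric v v ≤ 0 ∧ 0 < v.1

/-- The velocity of a curve defined on `[0,T]` (one-sided at the end points). -/
def velocity (γ : ℝ → Minkowski) (T t : ℝ) : Minkowski := derivWithin γ (Set.Icc 0 T) t

/-- Future directed causal `C¹` curves `γ : [0,T] → ℝ^{1,1}`. The case `T = 0` is the
one-point curve, which makes the causal relation reflexive, as is customary. -/
def IsCausalCurve (γ : ℝ → Minkowski) (T : ℝ) : Prop :=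
  0 ≤ T ∧ ContDiffOn ℝ 1 γ (Set.Icc 0 T) ∧
    (0 < T → ∀ t ∈ Set.Icc 0 T, IsFutureCausal (velocity γ T t))

/-- The proper time `l(γ)` of a causal curve. -/
def properTime (γ : ℝ → Minkowski) (T : ℝ) : ℝ :=
  ∫ t in (0 : ℝ)..T, √(-metric (velocity γ T t) (velocity γ T t))

/-- `p ⪯ q` in `ℝ^{1,1}`. -/
def Precedes (p q : Minkowski) : Prop :=
  ∃ (γ : ℝ → Minkowski) (T : ℝ), IsCausalCurve γ T ∧ γ 0 = p ∧ γ T = q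

/-- Causal functions: real functions that are non-decreasing along future directed causal
curves. -/
def IsCausalFunction (f : Minkowski → ℝ) : Prop :=
  ∀ (γ : ℝ → Minkowski) (T : ℝ), IsCausalCurve γ T → MonotoneOn (f ∘ γ) (Set.Icc 0 T)

/-! ### The algebra -/

/-- `C_M`: smooth causal functions that are bounded together with all their derivatives (the
case `n = 0` is the boundedness of the function), seen as complex functions. -/
def causalFunctions : Set (Minkowski → ℂ) :=
  {f | ∃ g : Minkowski → ℝ, ContDiff ℝ ∞ g ∧
    (∀ n : ℕ, ∃ C : ℝ, ∀ x, ‖iteratedFDeriv ℝ n g x‖ ≤ C) ∧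
    IsCausalFunction g ∧ ∀ x, f x = (g x : ℂ)}

/-- The unitisation of the algebra of Schwartz functions: the complex span of `C_M`. -/
def scalarAlgebra : Submodule ℂ (Minkowski → ℂ) := Submodule.span ℂ causalFunctions

/-- The complex `2 × 2` matrices. -/
abbrev Mat2 : Type := Matrix (Fin 2) (Fin 2) ℂ

/-- The unitisation of `S(ℝ^{1,1}) ⊗ M₂(ℂ)`: matrix functions with diagonal entries in the
span of the causal functions and with Schwartz off-diagonal entries. -/
def algebra : Submodule ℂ (Minkowski → Mat2) where
  carrier := {a | (∀ i, (fun x => a x i i) ∈ scalarAlgebra) ∧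
    ∀ i j, i ≠ j → ∃ f : 𝓢(Minkowski, ℂ), ∀ x, a x i j = f x}
  zero_mem' := ⟨fun _ => scalarAlgebra.zero_mem, fun _ _ _ => ⟨0, fun _ => rfl⟩⟩
  add_mem' := by
    rintro a b ⟨ha, ha'⟩ ⟨hb, hb'⟩
    refine ⟨fun i => scalarAlgebra.add_mem (ha i) (hb i), fun i j hij => ?_⟩
    obtain ⟨f, hf⟩ := ha' i j hij
    obtain ⟨g, hg⟩ := hb' i j hij
    exact ⟨f + g, fun x => by simp [hf, hg]⟩
  smul_mem' := by
    rintro c a ⟨ha, ha'⟩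
    refine ⟨fun i => scalarAlgebra.smul_mem c (ha i), fun i j hij => ?_⟩
    obtain ⟨f, hf⟩ := ha' i j hij
    exact ⟨c • f, fun x => by simp [hf]⟩

/-! ### The Hilbert space, the Dirac operator and the fundamental symmetry -/

/-- `ℂ² ⊗ ℂ²`; the first index is the spinor index, the second one is internal. -/
abbrev Spinor : Type := EuclideanSpace ℂ (Fin 2 × Fin 2)

/-- `L²(ℝ^{1,1}) ⊗ ℂ² ⊗ ℂ²`. -/
abbrev Hilbert : Type := Lp Spinor 2 (volume : Measure Minkowski)

/-- The operator on `ℂ² ⊗ ℂ²` given by a matrix. -/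
def op (A : Matrix (Fin 2 × Fin 2) (Fin 2 × Fin 2) ℂ) : Spinor →L[ℂ] Spinor :=
  Matrix.toEuclideanCLM (n := Fin 2 × Fin 2) (𝕜 := ℂ) A

def gamma0 : Mat2 := !![0, Complex.I; Complex.I, 0]

def gamma1 : Mat2 := !![0, -Complex.I; Complex.I, 0]

/-- The finite-part Dirac operator `diag(d₁, d₂)`. -/
def finiteDirac (d₁ d₂ : ℝ) : Mat2 := Matrix.diagonal ![(d₁ : ℂ), (d₂ : ℂ)]

/-- The Dirac operator `-i γ^μ ∂_μ ⊗ 1 + γ⁰γ¹ ⊗ diag(d₁, d₂)`, on differentiable spinors. -/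
def dirac (d₁ d₂ : ℝ) (φ : Minkowski → Spinor) (x : Minkowski) : Spinor :=
  (-Complex.I) • (op (gamma0 ⊗ₖ (1 : Mat2)) (fderiv ℝ φ x (1, 0)) +
    op (gamma1 ⊗ₖ (1 : Mat2)) (fderiv ℝ φ x (0, 1))) +
  op ((gamma0 * gamma1) ⊗ₖ finiteDirac d₁ d₂) (φ x)

/-- The representation of matrix functions on spinors. -/
def rep (a : Minkowski → Mat2) (φ : Minkowski → Spinor) (x : Minkowski) : Spinor :=
  op ((1 : Mat2) ⊗ₖ a x) (φ x)

/-- The fundamental symmetry `J = i γ⁰ ⊗ 1` on the Hilbert space. -/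
def fundamentalSymmetry : Hilbert →L[ℂ] Hilbert :=
  (op ((Complex.I • gamma0) ⊗ₖ (1 : Mat2))).compLpL 2 volume

/-- `B` is the bounded extension to the Hilbert space of the commutator `[D, a]`, which is
defined on the dense subspace of smooth spinors with compact support. -/
def ExtendsCommutator (d₁ d₂ : ℝ) (a : Minkowski → Mat2) (B : Hilbert →L[ℂ] Hilbert) : Prop :=
  ∀ φ : Minkowski → Spinor, ContDiff ℝ ∞ φ → HasCompactSupport φ →
    ∀ ψ : Hilbert, ψ =ᵐ[volume] φ →
      B ψ =ᵐ[volume] fun x => dirac d₁ d₂ (rep a φ) x - rep a (dirac d₁ d₂ φ) x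

/-- The causal cone: the Hermitian elements `a` of the algebra such that
`⟨φ, J [D, a] φ⟩ ≤ 0` for all `φ` in the Hilbert space. -/
def causalCone (d₁ d₂ : ℝ) : Set algebra :=
  {a | (∀ x, (a.1 x).IsHermitian) ∧
    ∃ B : Hilbert →L[ℂ] Hilbert, ExtendsCommutator d₁ d₂ a.1 B ∧
      ∀ φ : Hilbert, inner ℂ φ (fundamentalSymmetry (B φ)) ≤ 0}

/-! ### States -/

theorem one_mem_algebra : (1 : Minkowski → Mat2) ∈ algebra := by
  refine ⟨fun i => ?_, fun i j hij => ⟨0, fun x => by simp [hij]⟩⟩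
  refine Submodule.subset_span ⟨fun _ => 1, contDiff_const, fun n => ?_, ?_, fun x => by simp⟩
  · rcases Nat.eq_zero_or_pos n with rfl | hn
    · exact ⟨1, fun x => by simp⟩
    · exact ⟨0, fun x => by
        rw [iteratedFDeriv_const_of_ne (Nat.pos_iff_ne_zero.mp hn)]; simp⟩
  · intro γ T _ s _ t _ _
    exact le_rfl

/-- States: positive unital linear functionals that are continuous for the `C*`-norm
`sup_x ‖a(x)‖`; these are the restrictions of the states of the `C*`-completion. -/
structure State where
  toFun : algebra →ₗ[ℂ] ℂ
  unital : toFun ⟨1, one_mem_algebra⟩ = 1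
  positive : ∀ a b : algebra, (∀ x, b.1 x = (a.1 x)ᴴ * a.1 x) → 0 ≤ toFun b
  bounded : ∃ C : ℝ, ∀ (a : algebra) (K : ℝ),
    (∀ x, ‖Matrix.toEuclideanCLM (n := Fin 2) (𝕜 := ℂ) (a.1 x)‖ ≤ K) → ‖toFun a‖ ≤ C * K

/-- The causal relation between states. The value of a state on a Hermitian element is real. -/
def State.Precedes (d₁ d₂ : ℝ) (χ η : State) : Prop :=
  ∀ a ∈ causalCone d₁ d₂, (χ.toFun a).re ≤ (η.toFun a).re

/-- Density matrices, that is, the states of `M₂(ℂ)`. -/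
abbrev DensityMatrix : Type := {ρ : Mat2 // ρ.PosSemidef ∧ ρ.trace = 1}

/-- Pure density matrices `ξ ξ*`. -/
def IsPure (ρ : DensityMatrix) : Prop :=
  ∃ ξ : Fin 2 → ℂ, ρ.1 = Matrix.vecMulVec ξ (star ξ)

/-- The state `ω_{p,ρ}(a) = Tr(ρ a(p))`. -/
def productState (p : Minkowski) (ρ : DensityMatrix) : State where
  toFun :=
    { toFun := fun a => (ρ.1 * a.1 p).trace
      map_add' := fun a b => by simp [Matrix.mul_add]
      map_smul' := fun c a => by simp }
  unital := by simpa using ρ.2.2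
  positive := by
    intro a b hab
    have h := (ρ.2.1.mul_mul_conjTranspose_same (a.1 p)).trace_nonneg
    simp only [LinearMap.coe_mk, AddHom.coe_mk, hab]
    rwa [← Matrix.mul_assoc, Matrix.trace_mul_comm, ← Matrix.mul_assoc]
  bounded := by
    refine ⟨∑ i, ∑ j, ‖ρ.1 i j‖, fun a K hK => ?_⟩
    have entry : ∀ i j, ‖a.1 p i j‖ ≤ K := by
      intro i j
      have h1 := (Matrix.toEuclideanCLM (n := Fin 2) (𝕜 := ℂ) (a.1 p)).le_opNorm
        (EuclideanSpace.single j 1)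
      have h2 := PiLp.norm_apply_le
        (Matrix.toEuclideanCLM (n := Fin 2) (𝕜 := ℂ) (a.1 p) (EuclideanSpace.single j 1)) i
      have h3 : Matrix.toEuclideanCLM (n := Fin 2) (𝕜 := ℂ) (a.1 p)
          (EuclideanSpace.single j 1) i = a.1 p i j := by
        simp [Matrix.ofLp_toEuclideanCLM]
      rw [h3] at h2
      simp only [PiLp.norm_single, norm_one, mul_one] at h1
      exact h2.trans (h1.trans (hK p))
    simp only [LinearMap.coe_mk, AddHom.coe_mk, Matrix.trace, Matrix.diag, Matrix.mul_apply]
    rw [Finset.sum_mul]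
    refine (norm_sum_le _ _).trans (Finset.sum_le_sum fun i _ => ?_)
    rw [Finset.sum_mul]
    refine (norm_sum_le _ _).trans (Finset.sum_le_sum fun j _ => ?_)
    rw [norm_mul]
    exact mul_le_mul_of_nonneg_left (entry j i) (norm_nonneg _)

/-- The matrix `½ (1 + r_x σ_x + r_y σ_y + r_z σ_z)`, with the Pauli matrices written out. -/
def blochMatrix (r : EuclideanSpace ℝ (Fin 3)) : Mat2 :=
  (1 / 2 : ℂ) • ((1 : Mat2) + (r 0 : ℂ) • !![0, 1; 1, 0]
    + (r 1 : ℂ) • !![0, -Complex.I; Complex.I, 0] + (r 2 : ℂ) • !![1, 0; 0, -1])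

/-- A causal path of states `t ↦ ω_{γ(t),ρ(t)}`, for `t ∈ [0,T]`: a causal curve together with a
continuous family of density matrices such that earlier states precede later ones. -/
def IsCausalPath (d₁ d₂ : ℝ) (γ : ℝ → Minkowski) (T : ℝ) (ρ : ℝ → DensityMatrix) : Prop :=
  IsCausalCurve γ T ∧ ContinuousOn ρ (Set.Icc 0 T) ∧
    ∀ t ∈ Set.Icc 0 T, ∀ t' ∈ Set.Icc 0 T, t ≤ t' →
      (productState (γ t) (ρ t)).Precedes d₁ d₂ (productState (γ t') (ρ t'))

end AlmostCommutative

end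

open AlmostCommutative

open scoped ContDiff ComplexOrder Kronecker Matrix SchwartzMap
open MeasureTheory

noncomputable section

namespace AlmostCommutative

/-! ### Regularity of the elements of the algebra -/

/-! In `[D, a]` the derivatives of the spinor cancel, so the commutator is multiplication by a
bounded matrix function, and testing against localised spinors turns membership in the causal cone
into the pointwise sign condition `causalForm ≤ 0` (`causalForm_re_nonpos`, `mem_causalCone`). In
this form the two spinor components see the two light-cone derivatives of `a`, and the off-diagonal
entries of `a`, weighted by `d₁ - d₂`, couple them.

Sufficiency. A spinor adapted to a causal velocity turns the sign condition into a differential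
inequality: the expectation value of `a` cannot decrease along a causal curve if the state is pure,
its latitude `z` is fixed and its phase turns at a rate at most `|d₁ - d₂|` per unit of proper time
(`monotoneOn_transport`). This settles phase differences up to `l(γ)|d₁ - d₂|` on a circle of
latitude. A mixed state is a point of the disc bounded by this circle, and expectation values are
affine there. The later value depends only on the projection on one axis; the earlier value is at
most its maximum over the chord with the given projection, which is attained at an end of the chord.
So the arccosine condition on that axis reduces the disc to the circle
(`disc_inequality_of_circle`).

Necessity. Constant diagonal elements detect `z`, and monotone functions of null coordinates detect
the order of the base points. For the proper time, put `D = |d₁ - d₂|` and let `τ` be a boosted time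
coordinate. The cone contains, up to cutoffs, elements with diagonal `cot(β - Dτ)` and off-diagonal
`-1/sin(β - Dτ)` (after rescaling by latitude and phase). On a state with projection `x` such an
element takes the value `(cos ϑ - x)/sin ϑ`, where `ϑ = β - Dτ`, whose sign compares `ϑ` with
`arccos x`. If the arccosine dropped by more than `D` times the Lorentzian distance, some `β` would
give a positive value at `p` and a negative one at `q` (`arccos_le_of_blochValue_le`). The straight
segment realises this distance as proper time.

Part (2) applies the necessary condition to infinitesimally close points of the path, which bounds
the change of phase by the proper time of the given curve itself (`sub_le_properTime_of_causal`). A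
uniform rotation in proper time then joins the pure end states. -/

theorem scalarAlgebra_contDiff {f : Minkowski → ℂ} (hf : f ∈ scalarAlgebra) :
    ContDiff ℝ ∞ f := by
  refine Submodule.span_induction (p := fun f _ => ContDiff ℝ ∞ f) ?_ contDiff_const
    (fun f g _ _ hf hg => hf.add hg) (fun c f _ hf => hf.const_smul c) hf
  rintro f ⟨g, hg, -, -, hfg⟩
  rw [funext hfg]
  exact Complex.ofRealCLM.contDiff.comp hg

theorem scalarAlgebra_bounded {f : Minkowski → ℂ} (hf : f ∈ scalarAlgebra) :
    ∃ C : ℝ, ∀ x, ‖f x‖ ≤ C ∧ ‖fderiv ℝ f x‖ ≤ C := by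
  refine Submodule.span_induction
    (p := fun f _ => ∃ C : ℝ, ∀ x, ‖f x‖ ≤ C ∧ ‖fderiv ℝ f x‖ ≤ C) ?_ ⟨0, by simp⟩ ?_ ?_ hf
  · rintro f ⟨g, hg, hb, -, hfg⟩
    obtain ⟨C₀, h₀⟩ := hb 0
    obtain ⟨C₁, h₁⟩ := hb 1
    refine ⟨max C₀ C₁, fun x => ⟨?_, ?_⟩⟩
    · have := h₀ x
      rw [norm_iteratedFDeriv_zero] at this
      rw [hfg, Complex.norm_real]
      exact this.trans (le_max_left _ _)
    · have h := h₁ x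
      rw [norm_iteratedFDeriv_one] at h
      rw [funext hfg]
      have hd : HasFDerivAt (fun x => (g x : ℂ)) (Complex.ofRealCLM.comp (fderiv ℝ g x)) x :=
        Complex.ofRealCLM.hasFDerivAt.comp x (hg.differentiable (by simp) x).hasFDerivAt
      rw [hd.fderiv]
      refine le_trans (ContinuousLinearMap.opNorm_comp_le _ _) ?_
      rw [Complex.ofRealCLM_norm, one_mul]
      exact h.trans (le_max_right _ _)
  · rintro f g hf hg ⟨C, hC⟩ ⟨C', hC'⟩
    refine ⟨C + C', fun x => ⟨norm_add_le_of_le (hC x).1 (hC' x).1, ?_⟩⟩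
    rw [fderiv_add ((scalarAlgebra_contDiff hf).differentiable (by simp) x)
      ((scalarAlgebra_contDiff hg).differentiable (by simp) x)]
    exact norm_add_le_of_le (hC x).2 (hC' x).2
  · rintro c f hf ⟨C, hC⟩
    refine ⟨‖c‖ * C, fun x => ⟨?_, ?_⟩⟩
    · rw [Pi.smul_apply, norm_smul]
      exact mul_le_mul_of_nonneg_left (hC x).1 (norm_nonneg _)
    · rw [fderiv_const_smul ((scalarAlgebra_contDiff hf).differentiable (by simp) x), norm_smul]
      exact mul_le_mul_of_nonneg_left (hC x).2 (norm_nonneg _)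

theorem algebra_contDiff {a : Minkowski → Mat2} (ha : a ∈ algebra) (i j : Fin 2) :
    ContDiff ℝ ∞ (fun x => a x i j) := by
  by_cases hij : i = j
  · subst hij
    exact scalarAlgebra_contDiff (ha.1 i)
  · obtain ⟨f, hf⟩ := ha.2 i j hij
    rw [funext hf]
    exact f.smooth ⊤

theorem algebra_bounded {a : Minkowski → Mat2} (ha : a ∈ algebra) (i j : Fin 2) :
    ∃ C : ℝ, ∀ x, ‖a x i j‖ ≤ C ∧ ‖fderiv ℝ (fun y => a y i j) x‖ ≤ C := by
  by_cases hij : i = j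
  · subst hij
    exact scalarAlgebra_bounded (ha.1 i)
  · obtain ⟨f, hf⟩ := ha.2 i j hij
    rw [funext hf]
    obtain ⟨C₀, -, h₀⟩ := f.decay 0 0
    obtain ⟨C₁, -, h₁⟩ := f.decay 0 1
    refine ⟨max C₀ C₁, fun x => ⟨?_, ?_⟩⟩
    · have := h₀ x
      rw [pow_zero, one_mul, norm_iteratedFDeriv_zero] at this
      rw [hf]
      exact this.trans (le_max_left _ _)
    · have := h₁ x
      rw [pow_zero, one_mul, norm_iteratedFDeriv_one] at this
      exact this.trans (le_max_right _ _)

/-! ### The commutator as a multiplication operator -/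

/-- The matrix of directional derivatives of a matrix function. -/
def matDeriv (a : Minkowski → Mat2) (x v : Minkowski) : Mat2 :=
  Matrix.of fun i j => fderiv ℝ (fun y => a y i j) x v

/-- The matrix by which the commutator `[D, a]` acts at a point. -/
def commSymbol (d₁ d₂ : ℝ) (a : Minkowski → Mat2) (x : Minkowski) :
    Matrix (Fin 2 × Fin 2) (Fin 2 × Fin 2) ℂ :=
  (-Complex.I) • (gamma0 ⊗ₖ matDeriv a x (1, 0) + gamma1 ⊗ₖ matDeriv a x (0, 1)) +
    (gamma0 * gamma1) ⊗ₖ (finiteDirac d₁ d₂ * a x - a x * finiteDirac d₁ d₂)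

theorem op_apply (A : Matrix (Fin 2 × Fin 2) (Fin 2 × Fin 2) ℂ) (v : Spinor)
    (k : Fin 2 × Fin 2) : op A v k = ∑ l, A k l * v l := by
  simp [op, Matrix.ofLp_toEuclideanCLM, Matrix.mulVec, dotProduct]

theorem op_mul_apply (A B : Matrix (Fin 2 × Fin 2) (Fin 2 × Fin 2) ℂ) (v : Spinor) :
    op A (op B v) = op (A * B) v := by
  simp [op, map_mul]

/-- The coordinates of a spinor, as real-linear maps. -/
def coordL (k : Fin 2 × Fin 2) : Spinor →L[ℝ] ℂ :=
  (EuclideanSpace.proj k : Spinor →L[ℂ] ℂ).restrictScalars ℝ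

theorem coordL_apply (k : Fin 2 × Fin 2) (v : Spinor) : coordL k v = v k := rfl

theorem fderiv_rep {a : Minkowski → Mat2} {φ : Minkowski → Spinor} {x : Minkowski}
    (ha : ∀ i j, DifferentiableAt ℝ (fun y => a y i j) x) (hφ : DifferentiableAt ℝ φ x)
    (v : Minkowski) :
    fderiv ℝ (rep a φ) x v =
      op ((1 : Mat2) ⊗ₖ matDeriv a x v) (φ x) + op ((1 : Mat2) ⊗ₖ a x) (fderiv ℝ φ x v) := by
  have hφk : ∀ k, HasFDerivAt (fun y => φ y k)
      ((coordL k).comp (fderiv ℝ φ x)) x := fun k =>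
    (coordL k).hasFDerivAt.comp x hφ.hasFDerivAt
  have hrep : ∀ k : Fin 2 × Fin 2, HasFDerivAt (fun y => rep a φ y k)
      (∑ l : Fin 2 × Fin 2, (1 : Mat2) k.1 l.1 •
        (a x k.2 l.2 • ((coordL l).comp (fderiv ℝ φ x)) +
          φ x l • fderiv ℝ (fun y => a y k.2 l.2) x)) x := by
    intro k
    have : (fun y => rep a φ y k) =
        fun y => ∑ l : Fin 2 × Fin 2, (1 : Mat2) k.1 l.1 • (a y k.2 l.2 * φ y l) := by
      funext y
      simp [rep, op_apply, Matrix.kroneckerMap_apply, mul_assoc]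
    rw [this]
    refine HasFDerivAt.fun_sum fun l _ => ?_
    exact ((ha k.2 l.2).hasFDerivAt.mul (hφk l)).const_smul ((1 : Mat2) k.1 l.1)
  have hd : DifferentiableAt ℝ (rep a φ) x :=
    (differentiableAt_piLp 2).2 fun k => (hrep k).differentiableAt
  ext k
  have h1 : HasFDerivAt (fun y => rep a φ y k)
      ((coordL k).comp (fderiv ℝ (rep a φ) x)) x :=
    (coordL k).hasFDerivAt.comp x hd.hasFDerivAt
  have h2 := congrArg (fun L => L v) (h1.unique (hrep k))
  simp only [ContinuousLinearMap.comp_apply, coordL_apply] at h2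
  rw [h2]
  simp only [sum_apply, smul_apply,
    add_apply, ContinuousLinearMap.comp_apply, coordL_apply,
    PiLp.add_apply, op_apply, ← Finset.sum_add_distrib, Matrix.kroneckerMap_apply, matDeriv,
    Matrix.of_apply, smul_eq_mul]
  refine Finset.sum_congr rfl fun l _ => ?_
  ring

/-- The Leibniz terms in which `φ` is differentiated cancel, because the gamma matrices and `a` act
on different tensor factors; a zeroth-order operator remains. -/
theorem commutator_apply (d₁ d₂ : ℝ) {a : Minkowski → Mat2} {φ : Minkowski → Spinor}
    {x : Minkowski} (ha : ∀ i j, DifferentiableAt ℝ (fun y => a y i j) x)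
    (hφ : DifferentiableAt ℝ φ x) :
    dirac d₁ d₂ (rep a φ) x - rep a (dirac d₁ d₂ φ) x = op (commSymbol d₁ d₂ a x) (φ x) := by
  have hadd : ∀ (A B : Matrix (Fin 2 × Fin 2) (Fin 2 × Fin 2) ℂ) (v : Spinor),
    op (A + B) v = op A v + op B v := fun A B v => by simp [op]
  have hsub : ∀ (A B : Matrix (Fin 2 × Fin 2) (Fin 2 × Fin 2) ℂ) (v : Spinor),
    op (A - B) v = op A v - op B v := fun A B v => by simp [op]
  have hsmul : ∀ (c : ℂ) (A : Matrix (Fin 2 × Fin 2) (Fin 2 × Fin 2) ℂ) (v : Spinor),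
    op (c • A) v = c • op A v := fun c A v => by simp [op]
  have hk : ∀ A B C : Mat2, A ⊗ₖ (B - C) = A ⊗ₖ B - A ⊗ₖ C := fun A B C => by
    ext; simp [Matrix.kroneckerMap_apply, mul_sub]
  rw [dirac, fderiv_rep ha hφ, fderiv_rep ha hφ, commSymbol, hadd, hsmul, hadd, hk, hsub]
  simp only [rep, dirac, map_add, map_smul, op_mul_apply, ← Matrix.mul_kronecker_mul, mul_one,
    one_mul]
  module

theorem commSymbol_apply (d₁ d₂ : ℝ) (a : Minkowski → Mat2) (x : Minkowski)
    (k l : Fin 2 × Fin 2) :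
    commSymbol d₁ d₂ a x k l =
      -Complex.I * (gamma0 k.1 l.1 * fderiv ℝ (fun y => a y k.2 l.2) x (1, 0) +
        gamma1 k.1 l.1 * fderiv ℝ (fun y => a y k.2 l.2) x (0, 1)) +
      (gamma0 * gamma1) k.1 l.1 *
        ((![(d₁ : ℂ), (d₂ : ℂ)] k.2 - ![(d₁ : ℂ), (d₂ : ℂ)] l.2) * a x k.2 l.2) := by
  simp only [commSymbol, matDeriv, finiteDirac, Matrix.add_apply, Matrix.smul_apply,
    Matrix.kroneckerMap_apply, Matrix.of_apply, Matrix.sub_apply, Matrix.diagonal_mul,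
    Matrix.mul_diagonal, smul_eq_mul]
  ring

theorem op_eq_sum (A : Matrix (Fin 2 × Fin 2) (Fin 2 × Fin 2) ℂ) :
    op A = ∑ k, ∑ l, A k l • op (Matrix.single k l 1) := by
  conv_lhs => rw [Matrix.matrix_eq_sum_single A]
  simp only [op, map_sum]
  refine Finset.sum_congr rfl fun k _ => Finset.sum_congr rfl fun l _ => ?_
  rw [← map_smul, Matrix.smul_single, smul_eq_mul, mul_one]

theorem continuous_op_commSymbol (d₁ d₂ : ℝ) {a : Minkowski → Mat2} (ha : a ∈ algebra) :
    Continuous fun x => op (commSymbol d₁ d₂ a x) := by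
  rw [funext fun x => op_eq_sum (commSymbol d₁ d₂ a x)]
  refine continuous_finsetSum (Finset.univ : Finset (Fin 2 × Fin 2)) fun k _ =>
    continuous_finsetSum (Finset.univ : Finset (Fin 2 × Fin 2)) fun l _ => ?_
  suffices h : Continuous fun x => commSymbol d₁ d₂ a x k l from h.smul continuous_const
  simp_rw [commSymbol_apply]
  have h0 : Continuous fun x => a x k.2 l.2 := (algebra_contDiff ha k.2 l.2).continuous
  have h1 : Continuous fun x => fderiv ℝ (fun y => a y k.2 l.2) x :=
    (algebra_contDiff ha k.2 l.2).continuous_fderiv (by simp)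
  fun_prop

theorem bounded_op_commSymbol (d₁ d₂ : ℝ) {a : Minkowski → Mat2} (ha : a ∈ algebra) :
    ∃ C : ℝ, ∀ x, ‖op (commSymbol d₁ d₂ a x)‖ ≤ C := by
  have entry : ∀ k l, ∃ C : ℝ, ∀ x, ‖commSymbol d₁ d₂ a x k l‖ ≤ C := by
    intro k l
    obtain ⟨C, hC⟩ := algebra_bounded ha k.2 l.2
    have hv : ∀ (x v : Minkowski), ‖v‖ ≤ 1 → ‖fderiv ℝ (fun y => a y k.2 l.2) x v‖ ≤ C :=
      fun x v hv => ((ContinuousLinearMap.le_of_opNorm_le_of_le _ (hC x).2 hv).trans_eq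
        (mul_one C))
    refine ⟨‖-Complex.I‖ * (‖gamma0 k.1 l.1‖ * C + ‖gamma1 k.1 l.1‖ * C) +
      ‖(gamma0 * gamma1) k.1 l.1‖ *
        (‖![(d₁ : ℂ), (d₂ : ℂ)] k.2 - ![(d₁ : ℂ), (d₂ : ℂ)] l.2‖ * C), fun x => ?_⟩
    rw [commSymbol_apply]
    refine norm_add_le_of_le ?_ ?_
    · rw [norm_mul]
      refine mul_le_mul_of_nonneg_left (norm_add_le_of_le ?_ ?_) (norm_nonneg _)
      · rw [norm_mul]
        exact mul_le_mul_of_nonneg_left (hv x _ (by simp [Prod.norm_def])) (norm_nonneg _)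
      · rw [norm_mul]
        exact mul_le_mul_of_nonneg_left (hv x _ (by simp [Prod.norm_def])) (norm_nonneg _)
    · rw [norm_mul, norm_mul]
      gcongr
      exact (hC x).1
  choose C hC using entry
  refine ⟨∑ k, ∑ l, C k l * ‖op (Matrix.single k l 1)‖, fun x => ?_⟩
  rw [op_eq_sum]
  refine norm_sum_le_of_le _ fun k _ => norm_sum_le_of_le _ fun l _ => ?_
  rw [norm_smul]
  exact mul_le_mul_of_nonneg_right (hC k l x) (norm_nonneg _)

/-! ### Pointwise description of the causal cone -/

/-- The quadratic form `⟨ξ, J [D, a](x) ξ⟩` on spinors at the point `x`. -/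
def causalForm (d₁ d₂ : ℝ) (a : Minkowski → Mat2) (x : Minkowski) (ξ : Spinor) : ℂ :=
  inner ℂ ξ (op ((Complex.I • gamma0) ⊗ₖ (1 : Mat2)) (op (commSymbol d₁ d₂ a x) ξ))

theorem causalForm_smul (d₁ d₂ : ℝ) (a : Minkowski → Mat2) (x : Minkowski) (c : ℝ) (ξ : Spinor) :
    causalForm d₁ d₂ a x (c • ξ) = ((c ^ 2 : ℝ) : ℂ) * causalForm d₁ d₂ a x ξ := by
  have h : c • ξ = (c : ℂ) • ξ := rfl
  rw [h, causalForm, map_smul, map_smul, inner_smul_left, inner_smul_right, Complex.conj_ofReal,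
    causalForm]
  push_cast
  ring

theorem continuous_causalForm (d₁ d₂ : ℝ) {a : Minkowski → Mat2} (ha : a ∈ algebra) (ξ : Spinor) :
    Continuous fun x => causalForm d₁ d₂ a x ξ := by
  have h := continuous_op_commSymbol d₁ d₂ ha
  unfold causalForm
  fun_prop

/-- If the form were positive at one point, it would by continuity be positive on a ball, and a
constant spinor times a bump supported there would have positive expectation. -/
theorem causalForm_re_nonpos {d₁ d₂ : ℝ} {a : algebra} (ha : a ∈ causalCone d₁ d₂)
    (x : Minkowski) (ξ : Spinor) : (causalForm d₁ d₂ a.1 x ξ).re ≤ 0 := by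
  obtain ⟨-, B, hB, hneg⟩ := ha
  by_contra! hpos
  have hcont : Continuous fun y => (causalForm d₁ d₂ a.1 y ξ).re :=
    Complex.continuous_re.comp (continuous_causalForm d₁ d₂ a.2 ξ)
  obtain ⟨ε, hε, hball⟩ := Metric.isOpen_iff.1 (isOpen_lt continuous_const hcont) x hpos
  let χ : ContDiffBump x := ⟨ε / 2, ε, by positivity, by linarith⟩
  let φ : Minkowski → Spinor := fun y => χ y • ξ
  have hφ : ContDiff ℝ ∞ φ := χ.contDiff.smul contDiff_const
  have hφc : HasCompactSupport φ := χ.hasCompactSupport.smul_right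
  have hmem : MemLp φ 2 (volume : Measure Minkowski) :=
    hφ.continuous.memLp_of_hasCompactSupport hφc
  let ψ : Hilbert := hmem.toLp φ
  have hψ : ψ =ᵐ[volume] φ := hmem.coeFn_toLp
  have h1 := hB φ hφ hφc ψ hψ
  have h2 : fundamentalSymmetry (B ψ) =ᵐ[volume]
      fun y => op ((Complex.I • gamma0) ⊗ₖ (1 : Mat2)) (B ψ y) :=
    ContinuousLinearMap.coeFn_compLpL _ _
  have h3 : inner ℂ ψ (fundamentalSymmetry (B ψ)) =
      ∫ y, ((χ y ^ 2 : ℝ) : ℂ) * causalForm d₁ d₂ a.1 y ξ := by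
    rw [L2.inner_def]
    refine integral_congr_ae ?_
    filter_upwards [hψ, h1, h2] with y e1 e2 e3
    rw [e1, e3, e2, commutator_apply d₁ d₂
      (fun i j => (algebra_contDiff a.2 i j).differentiable (by simp) y)
      (hφ.differentiable (by simp) y), ← causalForm_smul]
    rfl
  have hc : Continuous fun y => ((χ y ^ 2 : ℝ) : ℂ) * causalForm d₁ d₂ a.1 y ξ :=
    (Complex.continuous_ofReal.comp (χ.continuous.pow 2)).mul (continuous_causalForm d₁ d₂ a.2 ξ)
  have hcs : HasCompactSupport fun y => ((χ y ^ 2 : ℝ) : ℂ) * causalForm d₁ d₂ a.1 y ξ := by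
    refine HasCompactSupport.mul_right ?_
    exact χ.hasCompactSupport.comp_left (g := fun t : ℝ => ((t ^ 2 : ℝ) : ℂ)) (by simp)
  have hint := hc.integrable_of_hasCompactSupport (μ := volume) hcs
  have h4 : (inner ℂ ψ (fundamentalSymmetry (B ψ))).re =
      ∫ y, χ y ^ 2 * (causalForm d₁ d₂ a.1 y ξ).re := by
    rw [h3]
    have := integral_re hint
    simp only [RCLike.re_to_complex, Complex.re_ofReal_mul] at this
    exact this.symm
  have h5 : 0 < ∫ y, χ y ^ 2 * (causalForm d₁ d₂ a.1 y ξ).re := by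
    refine Continuous.integral_pos_of_hasCompactSupport_nonneg_nonzero
      (x := x) ((χ.continuous.pow 2).mul hcont) ?_ ?_ ?_
    · exact HasCompactSupport.mul_right
        (χ.hasCompactSupport.comp_left (g := fun t : ℝ => t ^ 2) (by simp))
    · intro y
      by_cases hy : y ∈ Metric.ball x ε
      · exact mul_nonneg (sq_nonneg _) (le_of_lt (hball hy))
      · have : χ y = 0 := by
          rw [← Function.notMem_support, χ.support_eq]
          exact hy
        simp [this]
    · have : χ x = 1 := χ.one_of_mem_closedBall (Metric.mem_closedBall_self χ.rIn_pos.le)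
      rw [this]
      simpa using hpos.ne'
  have h6 := (Complex.le_def.1 (hneg ψ)).1
  rw [h4] at h6
  exact absurd h5 (not_lt.2 h6)

/-- The symbol is essentially bounded, so Hölder's inequality makes multiplication by it a bounded
operator; the pointwise sign is then integrated. -/
theorem mem_causalCone {d₁ d₂ : ℝ} {a : algebra} (hherm : ∀ x, (a.1 x).IsHermitian)
    (hneg : ∀ x ξ, causalForm d₁ d₂ a.1 x ξ ≤ 0) : a ∈ causalCone d₁ d₂ := by
  obtain ⟨C, hC⟩ := bounded_op_commSymbol d₁ d₂ a.2
  have hmem : MemLp (fun x => op (commSymbol d₁ d₂ a.1 x)) ⊤ (volume : Measure Minkowski) :=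
    memLp_top_of_bound (continuous_op_commSymbol d₁ d₂ a.2).aestronglyMeasurable C
      (.of_forall hC)
  let S := hmem.toLp _
  have hS : S =ᵐ[volume] fun x => op (commSymbol d₁ d₂ a.1 x) := hmem.coeFn_toLp
  let E : (Spinor →L[ℂ] Spinor) →L[ℂ] Spinor →L[ℂ] Spinor := ContinuousLinearMap.id ℂ _
  let B : Hilbert →L[ℂ] Hilbert := E.holderL volume ⊤ 2 2 S
  have hB : ∀ ψ : Hilbert, B ψ =ᵐ[volume] fun x => op (commSymbol d₁ d₂ a.1 x) (ψ x) := by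
    intro ψ
    filter_upwards [E.coeFn_holder (r := 2) S ψ, hS] with x h1 h2
    change E.holder 2 S ψ x = _
    rw [h1, h2]
    rfl
  refine ⟨hherm, B, fun φ hφ _ ψ hψ => ?_, fun φ => ?_⟩
  · filter_upwards [hB ψ, hψ] with x h1 h2
    rw [h1, h2, commutator_apply d₁ d₂
      (fun i j => (algebra_contDiff a.2 i j).differentiable (by simp) x)
      (hφ.differentiable (by simp) x)]
  · have h2 : fundamentalSymmetry (B φ) =ᵐ[volume]
        fun y => op ((Complex.I • gamma0) ⊗ₖ (1 : Mat2)) (B φ y) :=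
      ContinuousLinearMap.coeFn_compLpL _ _
    have h3 : inner ℂ φ (fundamentalSymmetry (B φ)) =
        ∫ y, ((causalForm d₁ d₂ a.1 y (φ y)).re : ℂ) := by
      rw [L2.inner_def]
      refine integral_congr_ae ?_
      filter_upwards [hB φ, h2] with y e2 e3
      rw [e3, e2]
      have := hneg y (φ y)
      exact Complex.ext rfl (by simpa [causalForm] using (Complex.le_def.1 this).2)
    rw [h3, integral_complex_ofReal]
    have : ∫ y, (causalForm d₁ d₂ a.1 y (φ y)).re ≤ 0 :=
      integral_nonpos fun y => (Complex.le_def.1 (hneg y (φ y))).1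
    exact_mod_cast this

/-- This displays the structure used in both directions: `∂₀ + ∂₁` on the first spinor component,
`∂₀ - ∂₁` on the second, and a coupling through the off-diagonal entries of `a`. -/
theorem causalForm_eq (d₁ d₂ : ℝ) (a : Minkowski → Mat2) (x : Minkowski) (ξ : Spinor) :
    causalForm d₁ d₂ a x ξ =
      -(∑ j, ∑ l, star (ξ (0, j)) * (matDeriv a x (1, 0) j l + matDeriv a x (0, 1) j l) *
          ξ (0, l))
      - (∑ j, ∑ l, star (ξ (1, j)) * (matDeriv a x (1, 0) j l - matDeriv a x (0, 1) j l) *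
          ξ (1, l))
      - (d₁ - d₂) * (star (ξ (0, 0)) * a x 0 1 * ξ (1, 1) - star (ξ (0, 1)) * a x 1 0 * ξ (1, 0)
        - star (ξ (1, 0)) * a x 0 1 * ξ (0, 1) + star (ξ (1, 1)) * a x 1 0 * ξ (0, 0)) := by
  rw [causalForm, PiLp.inner_apply]
  simp only [op_apply, Fintype.sum_prod_type, Fin.sum_univ_two, commSymbol_apply, gamma0, gamma1,
    Matrix.kroneckerMap_apply, matDeriv, Matrix.of_apply, Matrix.smul_apply, smul_eq_mul,
    Matrix.mul_apply, RCLike.inner_apply, Matrix.cons_val_zero, Matrix.cons_val_one,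
    Matrix.one_apply, Matrix.cons_val', Matrix.cons_val_fin_one, starRingEnd_apply]
  simp only [Fin.isValue, reduceIte, one_ne_zero, zero_ne_one, mul_zero, zero_mul, add_zero,
    zero_add, mul_one, sub_self]
  ring_nf
  simp only [Complex.I_pow_four]
  ring

theorem IsHermitian.apply_one_zero {A : Mat2} (hA : A.IsHermitian) : A 1 0 = star (A 0 1) :=
  (hA.apply 1 0).symm

theorem matDeriv_isHermitian {a : Minkowski → Mat2} (ha : ∀ x, (a x).IsHermitian)
    (x v : Minkowski) (hd : ∀ i j, DifferentiableAt ℝ (fun y => a y i j) x) :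
    (matDeriv a x v).IsHermitian := by
  ext i j
  have h : (fun y => a y i j) = fun y => star (a y j i) := funext fun y => ((ha y).apply i j).symm
  simp only [Matrix.conjTranspose_apply, matDeriv, Matrix.of_apply]
  rw [h]
  have := ((Complex.conjCLE : ℂ →L[ℝ] ℂ).hasFDerivAt.comp x (hd j i).hasFDerivAt)
  have h2 : HasFDerivAt (fun y => star (a y j i))
    ((Complex.conjCLE : ℂ →L[ℝ] ℂ).comp (fderiv ℝ (fun y => a y j i) x)) x := this
  rw [h2.fderiv]
  rfl

theorem matDeriv_eq (a : Minkowski → Mat2) (x v : Minkowski) (i j : Fin 2) :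
    matDeriv a x v i j = v.1 * matDeriv a x (1, 0) i j + v.2 * matDeriv a x (0, 1) i j := by
  have : v = v.1 • ((1, 0) : Minkowski) + v.2 • ((0, 1) : Minkowski) := by ext <;> simp
  conv_lhs => rw [this]
  simp only [matDeriv, Matrix.of_apply, map_add, map_smul, Complex.real_smul]

/-- The expectation value of a Hermitian matrix in the state with Bloch vector
`(re c, im c, z)`. -/
def blochValue (A : Mat2) (z : ℝ) (c : ℂ) : ℝ :=
  (1 + z) / 2 * (A 0 0).re + (1 - z) / 2 * (A 1 1).re + (c * A 0 1).re

theorem productState_re {ρ : DensityMatrix} {r : EuclideanSpace ℝ (Fin 3)}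
    (hρ : ρ.1 = blochMatrix r) (p : Minkowski) {a : algebra} (ha : (a.1 p).IsHermitian) :
    ((productState p ρ).toFun a).re = blochValue (a.1 p) (r 2) (r 0 + r 1 * Complex.I) := by
  have h10 := IsHermitian.apply_one_zero ha
  change ((ρ.1 * a.1 p).trace).re = _
  rw [hρ]
  simp [blochMatrix, Matrix.trace, Matrix.mul_apply, Fin.sum_univ_two, h10, blochValue]
  ring

theorem velocity_inequality_sign {d₁ d₂ : ℝ} {a : algebra} (ha : a ∈ causalCone d₁ d₂)
    (x v : Minkowski) (hp : 0 ≤ v.1 + v.2) (hm : 0 ≤ v.1 - v.2) (e₀ : ℝ) (e₁ : ℂ)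
    {c : ℝ} (hc : c ^ 2 = 1) :
    0 ≤ e₀ ^ 2 * (matDeriv a.1 x v 0 0).re + Complex.normSq e₁ * (matDeriv a.1 x v 1 1).re +
      2 * e₀ * (e₁ * matDeriv a.1 x v 0 1).re -
      2 * (c * (d₁ - d₂)) * (√(v.1 + v.2) * √(v.1 - v.2)) * e₀ * (e₁ * a.1 x 0 1).im := by
  set s := √(v.1 + v.2) with hs
  set t := √(v.1 - v.2) with ht
  have hs2 : s ^ 2 = v.1 + v.2 := Real.sq_sqrt hp
  have ht2 : t ^ 2 = v.1 - v.2 := Real.sq_sqrt hm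
  have h10 := IsHermitian.apply_one_zero (ha.1 x)
  have hd : ∀ i j, DifferentiableAt ℝ (fun y => a.1 y i j) x := fun i j =>
    (algebra_contDiff a.2 i j).differentiable (by simp) x
  have hh0 := IsHermitian.apply_one_zero (matDeriv_isHermitian ha.1 x (1, 0) hd)
  have hh1 := IsHermitian.apply_one_zero (matDeriv_isHermitian ha.1 x (0, 1) hd)
  -- The squared weights `v.1 ± v.2` combine the two light-cone derivatives into twice the
  -- derivative along `v`. The relative factor `I * c` selects the imaginary part of the coupling,
  -- with either sign.
  let ξ : Spinor := WithLp.toLp 2 fun k =>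
    if k.1 = 0 then (s : ℂ) * (if k.2 = 0 then (e₀ : ℂ) else e₁)
    else Complex.I * ((c * t : ℝ) : ℂ) * (if k.2 = 0 then (e₀ : ℂ) else e₁)
  have h := causalForm_re_nonpos ha x ξ
  rw [causalForm_eq] at h
  simp only [Fin.sum_univ_two, ξ, reduceIte, one_ne_zero, hh0, hh1, h10] at h
  rw [matDeriv_eq a.1 x v 0 0, matDeriv_eq a.1 x v 1 1, matDeriv_eq a.1 x v 0 1]
  have e1 : v.1 = (s ^ 2 + t ^ 2) / 2 := by rw [hs2, ht2]; ring
  have e2 : v.2 = (s ^ 2 - t ^ 2) / 2 := by rw [hs2, ht2]; ring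
  rw [e1, e2]
  generalize matDeriv a.1 x (1, 0) 0 0 = A at *
  generalize matDeriv a.1 x (1, 0) 1 1 = B at *
  generalize matDeriv a.1 x (1, 0) 0 1 = C at *
  generalize matDeriv a.1 x (0, 1) 0 0 = A' at *
  generalize matDeriv a.1 x (0, 1) 1 1 = B' at *
  generalize matDeriv a.1 x (0, 1) 0 1 = C' at *
  generalize a.1 x 0 1 = b at *
  clear_value s t
  simp only [Complex.add_re, Complex.sub_re, Complex.mul_re, Complex.neg_re, Complex.star_def,
    Complex.conj_re, Complex.conj_im, Complex.ofReal_re, Complex.ofReal_im, Complex.add_im,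
    Complex.sub_im, Complex.mul_im, Complex.I_re, Complex.I_im, Complex.normSq_apply] at h ⊢
  have hct : (c * t) ^ 2 = t ^ 2 := by rw [mul_pow, hc, one_mul]
  obtain ⟨m, hmm⟩ : ∃ m, m = c * t := ⟨_, rfl⟩
  rw [← hmm] at h hct
  have key : 2 * (c * (d₁ - d₂)) * (s * t) = 2 * (d₁ - d₂) * s * m := by rw [hmm]; ring
  rw [key]
  rw [← hct]
  linarith

/-- The two choices of sign bound the absolute value of the coupling term, and the product of the
two null weights is the Lorentzian length of `v`. -/
theorem velocity_inequality {d₁ d₂ : ℝ} {a : algebra} (ha : a ∈ causalCone d₁ d₂)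
    (x v : Minkowski) (hv : IsFutureCausal v) (e₀ : ℝ) (e₁ : ℂ)
    {κ : ℝ} (hκ : |κ| ≤ |d₁ - d₂|) :
    0 ≤ e₀ ^ 2 * (matDeriv a.1 x v 0 0).re + Complex.normSq e₁ * (matDeriv a.1 x v 1 1).re +
      2 * e₀ * (e₁ * matDeriv a.1 x v 0 1).re -
      2 * κ * √(-metric v v) * e₀ * (e₁ * a.1 x 0 1).im := by
  obtain ⟨h1, h2⟩ := hv
  have hmet : -metric v v = (v.1 + v.2) * (v.1 - v.2) := by rw [metric]; ring
  have hsq : v.2 ^ 2 ≤ v.1 ^ 2 := by rw [metric] at h1; nlinarith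
  have habs := abs_le_of_sq_le_sq' hsq h2.le
  have hp : 0 ≤ v.1 + v.2 := by linarith [habs.1]
  have hm : 0 ≤ v.1 - v.2 := by linarith [habs.2]
  have hplus := velocity_inequality_sign ha x v hp hm e₀ e₁ (c := 1) (by norm_num)
  have hminus := velocity_inequality_sign ha x v hp hm e₀ e₁ (c := -1) (by norm_num)
  rw [hmet, Real.sqrt_mul hp]
  set R := e₀ ^ 2 * (matDeriv a.1 x v 0 0).re + Complex.normSq e₁ * (matDeriv a.1 x v 1 1).re +
      2 * e₀ * (e₁ * matDeriv a.1 x v 0 1).re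
  set Y := 2 * (√(v.1 + v.2) * √(v.1 - v.2)) * e₀ * (e₁ * a.1 x 0 1).im with hY
  have hle : |(d₁ - d₂)| * |Y| ≤ R := by
    rw [← abs_mul, abs_le]
    constructor <;> rw [hY] <;> linarith
  have : κ * Y ≤ R := (le_abs_self _).trans <| (abs_mul κ Y).trans_le <|
    (mul_le_mul_of_nonneg_right hκ (abs_nonneg _)).trans hle
  rw [hY] at this
  linarith

/-! ### Transport of pure states along causal curves -/

/-- The proper time elapsed along a curve at the parameter `t`. -/
def elapsed (γ : ℝ → Minkowski) (T t : ℝ) : ℝ :=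
  ∫ u in (0 : ℝ)..t, √(-metric (velocity γ T u) (velocity γ T u))

theorem continuousOn_speed {γ : ℝ → Minkowski} {T : ℝ} (hγ : IsCausalCurve γ T) (hT : 0 < T) :
    ContinuousOn (fun u => √(-metric (velocity γ T u) (velocity γ T u))) (Set.Icc 0 T) := by
  have h : ContinuousOn (velocity γ T) (Set.Icc 0 T) :=
    hγ.2.1.continuousOn_derivWithin (uniqueDiffOn_Icc hT) le_rfl
  unfold metric
  fun_prop

theorem continuousOn_elapsed {γ : ℝ → Minkowski} {T : ℝ} (hγ : IsCausalCurve γ T) (hT : 0 < T) :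
    ContinuousOn (elapsed γ T) (Set.Icc 0 T) := by
  have h := (continuousOn_speed hγ hT).integrableOn_Icc (μ := volume)
  rw [← Set.uIcc_of_le hT.le] at h ⊢
  exact intervalIntegral.continuousOn_primitive_interval h

theorem hasDerivWithinAt_elapsed {γ : ℝ → Minkowski} {T : ℝ} (hγ : IsCausalCurve γ T)
    {t : ℝ} (ht : t ∈ Set.Ico 0 T) :
    HasDerivWithinAt (elapsed γ T) √(-metric (velocity γ T t) (velocity γ T t)) (Set.Ici t) t := by
  have hT : 0 < T := ht.1.trans_lt ht.2
  have hc := continuousOn_speed hγ hT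
  have hmem : Set.Icc 0 T ∈ nhdsWithin t (Set.Ioi t) :=
    Filter.mem_of_superset (Ioo_mem_nhdsGT ht.2) fun u hu => ⟨ht.1.trans hu.1.le, hu.2.le⟩
  refine intervalIntegral.integral_hasDerivWithinAt_right (s := Set.Ici t) (t := Set.Ioi t) ?_ ?_ ?_
  · rw [intervalIntegrable_iff_integrableOn_Icc_of_le ht.1]
    exact (hc.mono (Set.Icc_subset_Icc_right ht.2.le)).integrableOn_Icc
  · exact ⟨Set.Icc 0 T, hmem, hc.aestronglyMeasurable measurableSet_Icc⟩
  · exact (hc t ⟨ht.1, ht.2.le⟩).mono_of_mem_nhdsWithin hmem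

theorem hasDerivAt_elapsed {γ : ℝ → Minkowski} {T : ℝ} (hγ : IsCausalCurve γ T)
    {t : ℝ} (ht : t ∈ Set.Ioo 0 T) :
    HasDerivAt (elapsed γ T) √(-metric (velocity γ T t) (velocity γ T t)) t := by
  have hT : 0 < T := ht.1.trans ht.2
  have hc := continuousOn_speed hγ hT
  have hmem : Set.Icc 0 T ∈ nhds t := Icc_mem_nhds ht.1 ht.2
  refine intervalIntegral.integral_hasDerivAt_right ?_ ?_ ?_
  · rw [intervalIntegrable_iff_integrableOn_Icc_of_le ht.1.le]
    exact (hc.mono (Set.Icc_subset_Icc_right ht.2.le)).integrableOn_Icc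
  · exact ⟨Set.Icc 0 T, hmem, hc.aestronglyMeasurable measurableSet_Icc⟩
  · exact hc.continuousAt hmem

theorem hasDerivAt_causalCurve {γ : ℝ → Minkowski} {T : ℝ} (hγ : IsCausalCurve γ T)
    {t : ℝ} (ht : t ∈ Set.Ioo 0 T) : HasDerivAt γ (velocity γ T t) t :=
  ((hγ.2.1.differentiableOn one_ne_zero t ⟨ht.1.le, ht.2.le⟩).hasDerivWithinAt).hasDerivAt
    (Icc_mem_nhds ht.1 ht.2)

theorem hasDerivAt_entry {a : Minkowski → Mat2} (ha : a ∈ algebra) {γ : ℝ → Minkowski}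
    {v : Minkowski} {t : ℝ} (h : HasDerivAt γ v t) (i j : Fin 2) :
    HasDerivAt (fun u => a (γ u) i j) (matDeriv a (γ t) v i j) t :=
  ((algebra_contDiff ha i j).differentiable (by simp) (γ t)).hasFDerivAt.comp_hasDerivAt t h

theorem HasDerivAt.complex_re {f : ℝ → ℂ} {f' : ℂ} {t : ℝ} (h : HasDerivAt f f' t) :
    HasDerivAt (fun u => (f u).re) f'.re t :=
  Complex.reCLM.hasFDerivAt.comp_hasDerivAt t h

theorem hasDerivAt_blochValue {f : ℝ → Mat2} {f' : Mat2} {θ : ℝ → ℝ} {θ' t : ℝ}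
    (hf : ∀ i j, HasDerivAt (fun u => f u i j) (f' i j) t) (hθ : HasDerivAt θ θ' t) (N z : ℝ) :
    HasDerivAt (fun u => blochValue (f u) z (N * Complex.exp (θ u * Complex.I)))
      ((1 + z) / 2 * (f' 0 0).re + (1 - z) / 2 * (f' 1 1).re +
        (N * (Complex.exp (θ t * Complex.I) * (θ' * Complex.I)) * f t 0 1 +
          N * Complex.exp (θ t * Complex.I) * f' 0 1).re) t := by
  have he : HasDerivAt (fun u => (N : ℂ) * Complex.exp (θ u * Complex.I))
      (N * (Complex.exp (θ t * Complex.I) * (θ' * Complex.I))) t :=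
    (hθ.ofReal_comp.mul_const Complex.I).cexp.const_mul (N : ℂ)
  have h01 := HasDerivAt.complex_re (he.mul (hf 0 1))
  have h00 := (HasDerivAt.complex_re (hf 0 0)).const_mul ((1 + z) / 2)
  have h11 := (HasDerivAt.complex_re (hf 1 1)).const_mul ((1 - z) / 2)
  exact (h00.add h11).add h01

theorem continuousOn_blochValue {f : ℝ → Mat2} {θ : ℝ → ℝ} {s : Set ℝ}
    (hf : ∀ i j, ContinuousOn (fun u => f u i j) s) (hθ : ContinuousOn θ s) (N z : ℝ) :
    ContinuousOn (fun u => blochValue (f u) z (N * Complex.exp (θ u * Complex.I))) s := by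
  have h00 := Complex.continuous_re.comp_continuousOn (hf 0 0)
  have h11 := Complex.continuous_re.comp_continuousOn (hf 1 1)
  have h01 := hf 0 1
  have he : ContinuousOn (fun u => (N : ℂ) * Complex.exp (θ u * Complex.I)) s := by fun_prop
  exact ((h00.const_mul _).add (h11.const_mul _)).add
    (Complex.continuous_re.comp_continuousOn (he.mul h01))

theorem monotoneOn_transport {d₁ d₂ : ℝ} {a : algebra} (ha : a ∈ causalCone d₁ d₂)
    {γ : ℝ → Minkowski} {T : ℝ} (hγ : IsCausalCurve γ T) {z : ℝ} (hz : z ^ 2 ≤ 1)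
    (α : ℝ) {κ : ℝ} (hκ : |κ| ≤ |d₁ - d₂|) :
    MonotoneOn (fun t => blochValue (a.1 (γ t)) z
      (√(1 - z ^ 2) * Complex.exp ((α + κ * elapsed γ T t : ℝ) * Complex.I))) (Set.Icc 0 T) := by
  rcases hγ.1.eq_or_lt with rfl | hT
  · intro s hs t ht _
    rw [Set.Icc_self] at hs ht
    rw [hs, ht]
  obtain ⟨hz1, hz2⟩ := abs_le.1 ((sq_le_one_iff_abs_le_one z).1 hz)
  have hcont : ∀ i j, Continuous fun x => a.1 x i j := fun i j =>
    (algebra_contDiff a.2 i j).continuous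
  have hγc : ContinuousOn γ (Set.Icc 0 T) := hγ.2.1.continuousOn
  have hec := continuousOn_elapsed hγ hT
  have hent : ∀ i j, ContinuousOn (fun t => a.1 (γ t) i j) (Set.Icc 0 T) := fun i j =>
    (hcont i j).comp_continuousOn hγc
  have hderiv : ∀ t ∈ Set.Ioo 0 T, HasDerivAt (fun t => blochValue (a.1 (γ t)) z
      (√(1 - z ^ 2) * Complex.exp ((α + κ * elapsed γ T t : ℝ) * Complex.I)))
      ((1 + z) / 2 * (matDeriv a.1 (γ t) (velocity γ T t) 0 0).re +
        (1 - z) / 2 * (matDeriv a.1 (γ t) (velocity γ T t) 1 1).re +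
        (√(1 - z ^ 2) * (Complex.exp ((α + κ * elapsed γ T t : ℝ) * Complex.I) *
          ((κ * √(-metric (velocity γ T t) (velocity γ T t)) : ℝ) * Complex.I)) * a.1 (γ t) 0 1 +
          √(1 - z ^ 2) * Complex.exp ((α + κ * elapsed γ T t : ℝ) * Complex.I) *
          matDeriv a.1 (γ t) (velocity γ T t) 0 1).re) t := by
    intro t ht
    have hg := hasDerivAt_causalCurve hγ ht
    have hθ : HasDerivAt (fun u => α + κ * elapsed γ T u)
        (κ * √(-metric (velocity γ T t) (velocity γ T t))) t :=
      ((hasDerivAt_elapsed hγ ht).const_mul κ).const_add α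
    exact hasDerivAt_blochValue (f := fun u => a.1 (γ u))
      (f' := matDeriv a.1 (γ t) (velocity γ T t)) (hasDerivAt_entry a.2 hg) hθ √(1 - z ^ 2) z
  refine monotoneOn_of_deriv_nonneg (convex_Icc 0 T) ?_ ?_ ?_
  · exact continuousOn_blochValue hent ((hec.const_mul κ).const_add α) √(1 - z ^ 2) z
  · rw [interior_Icc]
    exact fun t ht => (hderiv t ht).differentiableAt.differentiableWithinAt
  · rw [interior_Icc]
    intro t ht
    rw [(hderiv t ht).deriv]
    set θ : ℝ := α + κ * elapsed γ T t
    -- The vector is that of the pure state at latitude `z` and phase `θ`. The coupling term is then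
    -- exactly the contribution of the rotating phase to the derivative.
    have h := velocity_inequality ha (γ t) (velocity γ T t) (hγ.2.2 hT t ⟨ht.1.le, ht.2.le⟩)
      √((1 + z) / 2) (√((1 - z) / 2) * Complex.exp (θ * Complex.I)) hκ
    have hN : √(1 - z ^ 2) = 2 * (√((1 + z) / 2) * √((1 - z) / 2)) := by
      rw [← Real.sqrt_mul (by linarith), show (1 - z ^ 2) = 2 ^ 2 * ((1 + z) / 2 * ((1 - z) / 2)) by
        ring, Real.sqrt_mul (by norm_num), Real.sqrt_sq (by norm_num)]
    have h0 : √((1 + z) / 2) ^ 2 = (1 + z) / 2 := Real.sq_sqrt (by linarith)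
    have h1 : √((1 - z) / 2) * √((1 - z) / 2) = (1 - z) / 2 := Real.mul_self_sqrt (by linarith)
    have hns : Complex.normSq (√((1 - z) / 2) * Complex.exp (θ * Complex.I)) = (1 - z) / 2 := by
      rw [map_mul, Complex.normSq_ofReal, h1, Complex.normSq_eq_norm_sq,
        Complex.norm_exp_ofReal_mul_I]
      ring
    rw [hns, h0] at h
    refine h.trans_eq ?_
    rw [hN]
    generalize Complex.exp (θ * Complex.I) = E
    simp only [Complex.add_re, Complex.mul_re, Complex.ofReal_re, Complex.ofReal_im,
      Complex.mul_im, Complex.I_re, Complex.I_im]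
    ring

theorem elapsed_zero (γ : ℝ → Minkowski) (T : ℝ) : elapsed γ T 0 = 0 := by simp [elapsed]

theorem properTime_nonneg {γ : ℝ → Minkowski} {T : ℝ} (hγ : IsCausalCurve γ T) :
    0 ≤ properTime γ T :=
  intervalIntegral.integral_nonneg hγ.1 fun _ _ => Real.sqrt_nonneg _

theorem blochValue_le_of_phase {d₁ d₂ : ℝ} {a : algebra} (ha : a ∈ causalCone d₁ d₂)
    {γ : ℝ → Minkowski} {T : ℝ} (hγ : IsCausalCurve γ T) {z : ℝ} (hz : z ^ 2 ≤ 1)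
    {α α' : ℝ} (h : |α' - α| ≤ properTime γ T * |d₁ - d₂|) :
    blochValue (a.1 (γ 0)) z (√(1 - z ^ 2) * Complex.exp (α * Complex.I)) ≤
      blochValue (a.1 (γ T)) z (√(1 - z ^ 2) * Complex.exp (α' * Complex.I)) := by
  have hl := properTime_nonneg hγ
  -- The phase turns at a constant rate in proper time. On a null curve the hypothesis forces `α' =
  -- α`, and division by zero gives rate `0`, as needed.
  have hkey : |(α' - α) / properTime γ T| ≤ |d₁ - d₂| ∧
      (α' - α) / properTime γ T * properTime γ T = α' - α := by
    rcases hl.eq_or_lt with h0 | h0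
    · rw [← h0, zero_mul] at h
      rw [abs_nonpos_iff.1 h]
      simp
    · exact ⟨by rw [abs_div, abs_of_pos h0, div_le_iff₀ h0, mul_comm]; exact h,
        div_mul_cancel₀ _ h0.ne'⟩
  have := monotoneOn_transport ha hγ hz α hkey.1 ⟨le_rfl, hγ.1⟩ ⟨hγ.1, le_rfl⟩ hγ.1
  simp only [elapsed_zero, mul_zero, add_zero] at this
  rw [show elapsed γ T T = properTime γ T from rfl, hkey.2, add_sub_cancel] at this
  exact this

/-! ### Mixed states -/

theorem exp_mul_polar_re (α B μ : ℝ) :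
    (Complex.exp (α * Complex.I) * (B * Complex.exp (μ * Complex.I))).re =
      B * Real.cos (α + μ) := by
  rw [mul_left_comm, ← Complex.exp_add, ← add_mul, ← Complex.ofReal_add, Complex.re_ofReal_mul,
    Complex.exp_ofReal_mul_I_re]

/-- If an inequality between affine functions holds for all pairs of points of the unit circle
with phase difference at most `L`, then it holds for pairs of points of the unit disc whose
projections on every axis have arccosines that differ by at most `L`. -/
theorem disc_inequality_of_circle {V V' N L : ℝ} {b b' : ℂ} (hN : 0 ≤ N)
    (h : ∀ α α' : ℝ, |α' - α| ≤ L → V + N * (Complex.exp (α * Complex.I) * b).re ≤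
      V' + N * (Complex.exp (α' * Complex.I) * b').re)
    {r s θr θs : ℝ} (hr : 0 ≤ r) (hr1 : r ≤ 1) (hs : 0 ≤ s) (hs1 : s ≤ 1)
    (hθ : ∀ θ, |Real.arccos (s * Real.cos (θs + θ)) - Real.arccos (r * Real.cos (θr + θ))| ≤ L) :
    V + N * (r * Complex.exp (θr * Complex.I) * b).re ≤
      V' + N * (s * Complex.exp (θs * Complex.I) * b').re := by
  have hb : b = ‖b‖ * Complex.exp (Complex.arg b * Complex.I) :=
    (Complex.norm_mul_exp_arg_mul_I b).symm
  have hb' : b' = (-‖b'‖ : ℝ) * Complex.exp (Complex.arg (-b') * Complex.I) := by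
    have := Complex.norm_mul_exp_arg_mul_I (-b')
    rw [norm_neg] at this
    rw [Complex.ofReal_neg, neg_mul, this, neg_neg]
  -- The axis is that of `b'`, so the right-hand side depends only on the projection `y`. The points
  -- of the circle with projections `x` and `y` are then compared.
  set ψ := Complex.arg (-b')
  set μ := Complex.arg b
  set x := r * Real.cos (θr + ψ) with hx
  set y := s * Real.cos (θs + ψ) with hy
  have hprod : ∀ r θ : ℝ, 0 ≤ r → r ≤ 1 → |r * Real.cos θ| ≤ 1 := fun r θ h0 h1 => by
    rw [abs_mul, abs_of_nonneg h0]
    exact mul_le_one₀ h1 (abs_nonneg _) (Real.abs_cos_le_one _)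
  obtain ⟨hx1, hx2⟩ := abs_le.1 (hprod r (θr + ψ) hr hr1)
  obtain ⟨hy1, hy2⟩ := abs_le.1 (hprod s (θs + ψ) hs hs1)
  have hcx : Real.cos (Real.arccos x) = x := Real.cos_arccos hx1 hx2
  have hcy : Real.cos (Real.arccos y) = y := Real.cos_arccos hy1 hy2
  have hsx : Real.sin (Real.arccos x) = √(1 - x ^ 2) := Real.sin_arccos x
  have hψ := hθ ψ
  have h1 := h (Real.arccos x - ψ) (Real.arccos y - ψ) (by
    rwa [sub_sub_sub_cancel_right])
  -- Reflection in the axis gives the other end of the chord with projection `x`. Together the two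
  -- ends bound the affine function on the whole chord.
  have h2 := h (-Real.arccos x - ψ) (-Real.arccos y - ψ) (by
    rw [sub_sub_sub_cancel_right, neg_sub_neg, abs_sub_comm]; exact hψ)
  rw [hb, hb', exp_mul_polar_re, exp_mul_polar_re, sub_add_cancel, hcy,
    show Real.arccos x - ψ + μ = Real.arccos x + (μ - ψ) by ring, Real.cos_add, hcx, hsx] at h1
  rw [hb, hb', exp_mul_polar_re, exp_mul_polar_re, sub_add_cancel, Real.cos_neg, hcy,
    show -Real.arccos x - ψ + μ = (μ - ψ) - Real.arccos x by ring, Real.cos_sub, hcx, hsx] at h2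
  rw [hb, hb', mul_assoc, Complex.re_ofReal_mul, exp_mul_polar_re, mul_assoc,
    Complex.re_ofReal_mul, exp_mul_polar_re, show θr + μ = (θr + ψ) + (μ - ψ) by ring,
    Real.cos_add]
  have hY : |r * Real.sin (θr + ψ)| ≤ √(1 - x ^ 2) := by
    refine Real.abs_le_sqrt ?_
    rw [hx]
    have := Real.sin_sq_add_cos_sq (θr + ψ)
    have : r ^ 2 * (Real.sin (θr + ψ) ^ 2 + Real.cos (θr + ψ) ^ 2) ≤ 1 := by
      rw [this]; nlinarith
    linarith
  set n := Real.sin (μ - ψ)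
  have hmax : -(r * Real.sin (θr + ψ) * n) ≤ √(1 - x ^ 2) * |n| := by
    refine (neg_le_abs _).trans ?_
    rw [abs_mul]
    exact mul_le_mul_of_nonneg_right hY (abs_nonneg _)
  have hVx : V + N * (‖b‖ * (x * Real.cos (μ - ψ) + √(1 - x ^ 2) * |n|)) ≤
      V' + N * (-‖b'‖ * y) := by
    rcases abs_choice n with hn | hn <;> rw [hn] <;> linarith
  have hstep : N * (‖b‖ * (x * Real.cos (μ - ψ) + -(r * Real.sin (θr + ψ) * n))) ≤
      N * (‖b‖ * (x * Real.cos (μ - ψ) + √(1 - x ^ 2) * |n|)) := by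
    gcongr
  have e1 : r * (‖b‖ * (Real.cos (θr + ψ) * Real.cos (μ - ψ) - Real.sin (θr + ψ) * n)) =
      ‖b‖ * (x * Real.cos (μ - ψ) + -(r * Real.sin (θr + ψ) * n)) := by rw [hx]; ring
  have e2 : s * (-‖b'‖ * Real.cos (θs + ψ)) = -‖b'‖ * y := by rw [hy]; ring
  rw [e1, e2]
  linarith

theorem blochValue_le_of_arccos {d₁ d₂ : ℝ} {a : algebra} (ha : a ∈ causalCone d₁ d₂)
    {γ : ℝ → Minkowski} {T : ℝ} (hγ : IsCausalCurve γ T) {z : ℝ} (hz : z ^ 2 ≤ 1)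
    {r s θr θs : ℝ} (hr : 0 ≤ r) (hr1 : r ≤ 1) (hs : 0 ≤ s) (hs1 : s ≤ 1)
    (hθ : ∀ θ, |Real.arccos (s * Real.cos (θs + θ)) - Real.arccos (r * Real.cos (θr + θ))| ≤
      properTime γ T * |d₁ - d₂|) :
    blochValue (a.1 (γ 0)) z (√(1 - z ^ 2) * (r * Complex.exp (θr * Complex.I))) ≤
      blochValue (a.1 (γ T)) z (√(1 - z ^ 2) * (s * Complex.exp (θs * Complex.I))) := by
  have h := disc_inequality_of_circle (N := √(1 - z ^ 2))
    (V := (1 + z) / 2 * (a.1 (γ 0) 0 0).re + (1 - z) / 2 * (a.1 (γ 0) 1 1).re)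
    (V' := (1 + z) / 2 * (a.1 (γ T) 0 0).re + (1 - z) / 2 * (a.1 (γ T) 1 1).re)
    (b := a.1 (γ 0) 0 1) (b' := a.1 (γ T) 0 1) (Real.sqrt_nonneg _) ?_ hr hr1 hs hs1 hθ
  · simpa only [blochValue, mul_assoc, Complex.re_ofReal_mul] using h
  · intro α α' hα
    simpa only [blochValue, mul_assoc, Complex.re_ofReal_mul] using
      blochValue_le_of_phase ha hγ hz hα

/-! ### Causal functions of one linear coordinate -/

/-- The future cone is spanned by the null vectors `(1, 1)` and `(1, -1)`, so positivity on these
two is enough. -/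
theorem map_futureCausal_nonneg {ℓ : Minkowski →L[ℝ] ℝ} (hp : 0 ≤ ℓ (1, 1)) (hm : 0 ≤ ℓ (1, -1))
    {v : Minkowski} (hv : IsFutureCausal v) : 0 ≤ ℓ v := by
  obtain ⟨h1, h2⟩ := hv
  have hsq : v.2 ^ 2 ≤ v.1 ^ 2 := by rw [metric] at h1; nlinarith
  have habs := abs_le_of_sq_le_sq' hsq h2.le
  have : v = ((v.1 + v.2) / 2) • ((1, 1) : Minkowski) + ((v.1 - v.2) / 2) • (1, -1) := by
    ext <;> simp <;> ring
  rw [this, map_add, map_smul, map_smul, smul_eq_mul, smul_eq_mul]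
  have := mul_nonneg (show 0 ≤ (v.1 + v.2) / 2 by linarith [habs.1]) hp
  have := mul_nonneg (show 0 ≤ (v.1 - v.2) / 2 by linarith [habs.2]) hm
  linarith

theorem monotoneOn_linear_comp_causalCurve {ℓ : Minkowski →L[ℝ] ℝ} (hp : 0 ≤ ℓ (1, 1))
    (hm : 0 ≤ ℓ (1, -1)) {γ : ℝ → Minkowski} {T : ℝ} (hγ : IsCausalCurve γ T) :
    MonotoneOn (fun t => ℓ (γ t)) (Set.Icc 0 T) := by
  rcases hγ.1.eq_or_lt with rfl | hT
  · intro s hs t ht _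
    rw [Set.Icc_self] at hs ht
    rw [hs, ht]
  have hderiv : ∀ t ∈ Set.Ioo 0 T, HasDerivAt (fun t => ℓ (γ t)) (ℓ (velocity γ T t)) t :=
    fun t ht => ℓ.hasFDerivAt.comp_hasDerivAt t (hasDerivAt_causalCurve hγ ht)
  refine monotoneOn_of_deriv_nonneg (convex_Icc 0 T)
    (ℓ.continuous.comp_continuousOn hγ.2.1.continuousOn) ?_ ?_
  · rw [interior_Icc]
    exact fun t ht => (hderiv t ht).differentiableAt.differentiableWithinAt
  · rw [interior_Icc]
    intro t ht
    rw [(hderiv t ht).deriv]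
    exact map_futureCausal_nonneg hp hm (hγ.2.2 hT t ⟨ht.1.le, ht.2.le⟩)

theorem bounded_of_hasCompactSupport_deriv {g : ℝ → ℝ} (hg : ContDiff ℝ ∞ g)
    (hc : HasCompactSupport (deriv g)) : ∃ C : ℝ, ∀ t, ‖g t‖ ≤ C := by
  have hcont : Continuous (deriv g) := hg.continuous_deriv (by simp)
  have hint : Integrable (deriv g) := hcont.integrable_of_hasCompactSupport hc
  refine ⟨‖g 0‖ + ∫ t, ‖deriv g t‖, fun t => ?_⟩
  have h : ∫ u in (0 : ℝ)..t, deriv g u = g t - g 0 :=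
    intervalIntegral.integral_deriv_eq_sub (fun u _ => hg.differentiable (by simp) u)
      (hcont.intervalIntegrable 0 t)
  have h2 : ‖g t - g 0‖ ≤ ∫ t, ‖deriv g t‖ := by
    rw [← h]
    exact intervalIntegral.norm_integral_le_integral_norm_uIoc.trans
      (setIntegral_le_integral hint.norm (.of_forall fun _ => norm_nonneg _))
  calc ‖g t‖ = ‖g 0 + (g t - g 0)‖ := by rw [add_sub_cancel]
    _ ≤ _ := norm_add_le_of_le le_rfl h2

/-- Derivatives of the composite are not compactly supported on the plane, but they are bounded by
those of `g` times powers of `‖ℓ‖`. -/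
theorem comp_linear_mem_scalarAlgebra {g : ℝ → ℝ} (hg : ContDiff ℝ ∞ g)
    (hc : HasCompactSupport (deriv g)) (hmono : Monotone g) {ℓ : Minkowski →L[ℝ] ℝ}
    (hp : 0 ≤ ℓ (1, 1)) (hm : 0 ≤ ℓ (1, -1)) :
    (fun x => ((g (ℓ x) : ℝ) : ℂ)) ∈ scalarAlgebra := by
  refine Submodule.subset_span ⟨fun x => g (ℓ x), hg.comp ℓ.contDiff, fun n => ?_, ?_,
    fun _ => rfl⟩
  · obtain ⟨C, hC⟩ : ∃ C : ℝ, ∀ t, ‖iteratedFDeriv ℝ n g t‖ ≤ C := by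
      simp_rw [norm_iteratedFDeriv_eq_norm_iteratedDeriv]
      cases n with
      | zero => simpa using bounded_of_hasCompactSupport_deriv hg hc
      | succ n =>
        have hg' : ContDiff ℝ ∞ (deriv g) := (contDiff_infty_iff_deriv.1 hg).2
        simp_rw [iteratedDeriv_succ', ← norm_iteratedFDeriv_eq_norm_iteratedDeriv]
        exact (hg'.continuous_iteratedFDeriv (m := n)
          (by exact_mod_cast le_top)).bounded_above_of_compact_support (hc.iteratedFDeriv n)
    refine ⟨C * ∏ _i : Fin n, ‖ℓ‖, fun x => ?_⟩
    have := ℓ.iteratedFDeriv_comp_right (hg.of_le (show ((n : ℕ∞) : WithTop ℕ∞) ≤ ∞ from by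
      exact_mod_cast le_top)) x (i := n) le_rfl
    change ‖iteratedFDeriv ℝ n (g ∘ ℓ) x‖ ≤ _
    rw [this]
    refine (ContinuousMultilinearMap.norm_compContinuousLinearMap_le _ _).trans ?_
    exact mul_le_mul_of_nonneg_right (hC _) (Finset.prod_nonneg fun _ _ => norm_nonneg _)
  · exact fun γ T hγ => hmono.comp_monotoneOn (monotoneOn_linear_comp_causalCurve hp hm hγ)

theorem const_mem_scalarAlgebra (c : ℝ) : (fun _ => (c : ℂ)) ∈ scalarAlgebra := by
  have := comp_linear_mem_scalarAlgebra (g := fun _ => c) contDiff_const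
    (by rw [deriv_const']; exact HasCompactSupport.zero) monotone_const (ℓ := 0) le_rfl le_rfl
  simpa using this

/-! ### A family of elements of the causal cone -/

/-- The Hermitian matrix function with diagonal `(k₀² A, k₁² A)` and off-diagonal entry
`-k₀ k₁ e B`. -/
def testFunction (A B : Minkowski → ℝ) (k₀ k₁ : ℝ) (e : ℂ) (x : Minkowski) : Mat2 :=
  !![((k₀ ^ 2 : ℝ) : ℂ) * A x, -(k₀ * k₁ * e) * B x;
    -(k₀ * k₁ * star e) * B x, ((k₁ ^ 2 : ℝ) : ℂ) * A x]

theorem testFunction_mem {A B : Minkowski → ℝ} (hA : (fun x => (A x : ℂ)) ∈ scalarAlgebra)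
    (hB : ContDiff ℝ ∞ B) (hBc : HasCompactSupport B) (k₀ k₁ : ℝ) (e : ℂ) :
    testFunction A B k₀ k₁ e ∈ algebra := by
  have hBC : ContDiff ℝ ∞ fun x => (B x : ℂ) := Complex.ofRealCLM.contDiff.comp hB
  have hBS : HasCompactSupport fun x => (B x : ℂ) :=
    hBc.comp_left (g := fun t : ℝ => (t : ℂ)) Complex.ofReal_zero
  let S : 𝓢(Minkowski, ℂ) := hBS.toSchwartzMap hBC
  have hS : ∀ x, S x = (B x : ℂ) := fun x => rfl
  refine ⟨fun i => ?_, fun i j hij => ?_⟩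
  · fin_cases i
    · exact scalarAlgebra.smul_mem ((k₀ ^ 2 : ℝ) : ℂ) hA
    · exact scalarAlgebra.smul_mem ((k₁ ^ 2 : ℝ) : ℂ) hA
  · fin_cases i <;> fin_cases j
    · exact absurd rfl hij
    · exact ⟨(-(k₀ * k₁ * e)) • S, fun x => by simp [testFunction, hS]⟩
    · exact ⟨(-(k₀ * k₁ * star e)) • S, fun x => by simp [testFunction, hS]⟩
    · exact absurd rfl hij

theorem testFunction_isHermitian (A B : Minkowski → ℝ) (k₀ k₁ : ℝ) (e : ℂ) (x : Minkowski) :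
    (testFunction A B k₀ k₁ e x).IsHermitian := by
  ext i j
  fin_cases i <;> fin_cases j <;> simp [testFunction]

theorem binary_quadratic_nonneg {α β m : ℝ} (hα : 0 ≤ α) (hβ : 0 ≤ β) (h : m ^ 2 ≤ α * β)
    (s t : ℝ) : 0 ≤ α * s ^ 2 + β * t ^ 2 + 2 * m * (s * t) := by
  rcases hα.eq_or_lt with rfl | hα'
  · have hm : m = 0 := by nlinarith
    rw [hm]
    nlinarith [mul_nonneg hβ (sq_nonneg t)]
  · have : 0 ≤ α * (α * s ^ 2 + β * t ^ 2 + 2 * m * (s * t)) := by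
      nlinarith [sq_nonneg (α * s + m * t), mul_nonneg (sub_nonneg.2 h) (sq_nonneg t)]
    exact nonneg_of_mul_nonneg_right this hα'

/-- In the variables `X₁ ± X₂` and `X₃ ∓ X₄` the form splits into two binary forms, whose
discriminant conditions are `h5` and `h6`. -/
theorem spinor_form_nonneg {P Q p q m : ℝ} (h1 : 0 ≤ P - p) (h2 : 0 ≤ P + p) (h3 : 0 ≤ Q - q)
    (h4 : 0 ≤ Q + q) (h5 : m ^ 2 ≤ (P - p) * (Q + q)) (h6 : m ^ 2 ≤ (P + p) * (Q - q))
    (X₁ X₂ X₃ X₄ : ℂ) :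
    0 ≤ P * (Complex.normSq X₁ + Complex.normSq X₂) - 2 * p * (star X₁ * X₂).re +
      Q * (Complex.normSq X₃ + Complex.normSq X₄) - 2 * q * (star X₃ * X₄).re -
      2 * m * (star X₁ * X₄ - star X₂ * X₃).re := by
  have hm : (-m) ^ 2 ≤ (P + p) * (Q - q) := by rwa [neg_sq]
  have e1 := binary_quadratic_nonneg h1 h4 h5 (X₁.re + X₂.re) (X₃.re - X₄.re)
  have e2 := binary_quadratic_nonneg h1 h4 h5 (X₁.im + X₂.im) (X₃.im - X₄.im)
  have e3 := binary_quadratic_nonneg h2 h3 hm (X₁.re - X₂.re) (X₃.re + X₄.re)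
  have e4 := binary_quadratic_nonneg h2 h3 hm (X₁.im - X₂.im) (X₃.im + X₄.im)
  simp only [Complex.normSq_apply, Complex.mul_re, Complex.sub_re, Complex.star_def,
    Complex.conj_re, Complex.conj_im]
  linarith

theorem matDeriv_testFunction {A B : Minkowski → ℝ} {x : Minkowski} (hA : DifferentiableAt ℝ A x)
    (hB : DifferentiableAt ℝ B x) (k₀ k₁ : ℝ) (e : ℂ) (v : Minkowski) :
    matDeriv (testFunction A B k₀ k₁ e) x v =
      testFunction (fun _ => fderiv ℝ A x v) (fun _ => fderiv ℝ B x v) k₀ k₁ e x := by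
  have key : ∀ (c : ℂ) {f : Minkowski → ℝ}, DifferentiableAt ℝ f x →
      fderiv ℝ (fun y => c * (f y : ℂ)) x v = c * (fderiv ℝ f x v : ℂ) := by
    intro c f hf
    have h : HasFDerivAt (fun y => (f y : ℂ)) (Complex.ofRealCLM.comp (fderiv ℝ f x)) x :=
      Complex.ofRealCLM.hasFDerivAt.comp x hf.hasFDerivAt
    rw [(h.const_mul c).fderiv]
    simp
  ext i j
  fin_cases i <;> fin_cases j
  · exact key _ hA
  · exact key _ hB
  · exact key _ hB
  · exact key _ hA

theorem testFunction_mem_causalCone {d₁ d₂ : ℝ} {A B : Minkowski → ℝ}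
    (hA : (fun x => (A x : ℂ)) ∈ scalarAlgebra) (hAd : Differentiable ℝ A)
    (hB : ContDiff ℝ ∞ B) (hBc : HasCompactSupport B) (k₀ k₁ : ℝ) {e : ℂ} (he : ‖e‖ = 1)
    (h1 : ∀ x, 0 ≤ fderiv ℝ A x (1, 1) - fderiv ℝ B x (1, 1))
    (h2 : ∀ x, 0 ≤ fderiv ℝ A x (1, 1) + fderiv ℝ B x (1, 1))
    (h3 : ∀ x, 0 ≤ fderiv ℝ A x (1, -1) - fderiv ℝ B x (1, -1))
    (h4 : ∀ x, 0 ≤ fderiv ℝ A x (1, -1) + fderiv ℝ B x (1, -1))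
    (h5 : ∀ x, ((d₁ - d₂) * B x) ^ 2 ≤ (fderiv ℝ A x (1, 1) - fderiv ℝ B x (1, 1)) *
      (fderiv ℝ A x (1, -1) + fderiv ℝ B x (1, -1)))
    (h6 : ∀ x, ((d₁ - d₂) * B x) ^ 2 ≤ (fderiv ℝ A x (1, 1) + fderiv ℝ B x (1, 1)) *
      (fderiv ℝ A x (1, -1) - fderiv ℝ B x (1, -1))) :
    (⟨testFunction A B k₀ k₁ e, testFunction_mem hA hB hBc k₀ k₁ e⟩ : algebra) ∈
      causalCone d₁ d₂ := by
  refine mem_causalCone (testFunction_isHermitian A B k₀ k₁ e) fun x ξ => ?_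
  -- Absorbing `k₀`, `k₁` and the phase `e` into the spinor reduces the causal form to one in the
  -- light-cone derivatives of `A` and `B`.
  have hq := spinor_form_nonneg (h1 x) (h2 x) (h3 x) (h4 x) (h5 x) (h6 x)
    (k₀ * ξ (0, 0)) (k₁ * e * ξ (0, 1)) (k₀ * ξ (1, 0)) (k₁ * e * ξ (1, 1))
  have hBd := hB.differentiable (by simp)
  have e1 : ∀ f : Minkowski → ℝ, fderiv ℝ f x (1, 1) =
      fderiv ℝ f x (1, 0) + fderiv ℝ f x (0, 1) := fun f => by
    rw [← map_add]; simp
  have e2 : ∀ f : Minkowski → ℝ, fderiv ℝ f x (1, -1) =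
      fderiv ℝ f x (1, 0) - fderiv ℝ f x (0, 1) := fun f => by
    rw [← map_sub]; simp
  rw [e1, e1, e2, e2] at hq
  have hn : e.re ^ 2 + e.im ^ 2 = 1 := by
    have := Complex.sq_norm e
    rw [he, Complex.normSq_apply] at this
    linarith
  rw [causalForm_eq, matDeriv_testFunction (hAd x) (hBd x), matDeriv_testFunction (hAd x) (hBd x)]
  simp only [Fin.sum_univ_two, testFunction, Matrix.of_apply, Matrix.cons_val_zero,
    Matrix.cons_val_one, Matrix.cons_val', Matrix.cons_val_fin_one]
  generalize fderiv ℝ A x (1, 0) = A0 at *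
  generalize fderiv ℝ A x (0, 1) = A1 at *
  generalize fderiv ℝ B x (1, 0) = B0 at *
  generalize fderiv ℝ B x (0, 1) = B1 at *
  generalize B x = b at *
  generalize ξ (0, 0) = y₁ at *
  generalize ξ (0, 1) = y₂ at *
  generalize ξ (1, 0) = y₃ at *
  generalize ξ (1, 1) = y₄ at *
  simp only [Complex.normSq_apply, Complex.mul_re, Complex.mul_im, Complex.sub_re,
    Complex.star_def, Complex.conj_re, Complex.conj_im, Complex.ofReal_re,
    Complex.ofReal_im] at hq
  rw [Complex.le_def]
  simp only [Complex.add_re, Complex.sub_re, Complex.mul_re, Complex.neg_re, Complex.star_def,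
    Complex.conj_re, Complex.conj_im, Complex.ofReal_re, Complex.ofReal_im, Complex.add_im,
    Complex.sub_im, Complex.mul_im, Complex.neg_im, Complex.zero_re, Complex.zero_im]
  constructor
  · refine le_of_sub_nonneg (hq.trans_eq ?_)
    linear_combination ((A0 + A1) * k₁ ^ 2 * (y₂.re ^ 2 + y₂.im ^ 2) +
      (A0 - A1) * k₁ ^ 2 * (y₄.re ^ 2 + y₄.im ^ 2)) * hn
  · ring

theorem blochValue_testFunction (A B : Minkowski → ℝ) (k₀ k₁ : ℝ) (e : ℂ) (x : Minkowski)
    (z : ℝ) (c : ℂ) :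
    blochValue (testFunction A B k₀ k₁ e x) z c =
      ((1 + z) / 2 * k₀ ^ 2 + (1 - z) / 2 * k₁ ^ 2) * A x - k₀ * k₁ * B x * (c * e).re := by
  simp only [blochValue, testFunction, Matrix.of_apply, Matrix.cons_val_zero,
    Matrix.cons_val_one, Matrix.cons_val', Matrix.cons_val_fin_one, Complex.mul_re,
    Complex.ofReal_re, Complex.ofReal_im, Complex.neg_re, Complex.neg_im, Complex.mul_im]
  ring

/-! ### Conditions on the base points and on the polar angle -/

/-- Constant multiples, of either sign, of the projection on the first internal component commute
with the Dirac operator and hence lie in the cone; their expectation is determined by `z`. -/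
theorem eq_of_blochValue_le {d₁ d₂ : ℝ} {p q : Minkowski} {z z' : ℝ} {c c' : ℂ}
    (h : ∀ a ∈ causalCone d₁ d₂, blochValue (a.1 p) z c ≤ blochValue (a.1 q) z' c') :
    z = z' := by
  have key : ∀ k : ℝ, (1 + z) / 2 * k ≤ (1 + z') / 2 * k := fun k => by
    have hmem := testFunction_mem_causalCone (d₁ := d₁) (d₂ := d₂) (A := fun _ => k)
      (B := fun _ => 0) (e := 1) (const_mem_scalarAlgebra k) (differentiable_const _)
      contDiff_const HasCompactSupport.zero 1 0 (by simp) (by simp) (by simp) (by simp) (by simp)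
      (by simp) (by simp)
    have := h _ hmem
    simpa only [blochValue_testFunction, one_pow, mul_one, zero_pow two_ne_zero, mul_zero,
      add_zero, zero_mul, sub_zero] using this
  linarith [key 1, key (-1)]

theorem linear_le_of_blochValue_le {d₁ d₂ : ℝ} {p q : Minkowski} {z z' : ℝ} {c c' : ℂ}
    (h : ∀ a ∈ causalCone d₁ d₂, blochValue (a.1 p) z c ≤ blochValue (a.1 q) z' c')
    {ℓ : Minkowski →L[ℝ] ℝ} (hp : 0 ≤ ℓ (1, 1)) (hm : 0 ≤ ℓ (1, -1)) : ℓ p ≤ ℓ q := by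
  by_contra! hlt
  have hpos : 0 < (ℓ p - ℓ q)⁻¹ := inv_pos.2 (sub_pos.2 hlt)
  -- A step from `0` at `ℓ q` to `1` at `ℓ p`; times the identity it would decrease from `p` to `q`.
  let g : ℝ → ℝ := fun t => Real.smoothTransition ((ℓ p - ℓ q)⁻¹ * (t - ℓ q))
  have hg : ContDiff ℝ ∞ g :=
    Real.smoothTransition.contDiff.comp (contDiff_const.mul (contDiff_id.sub contDiff_const))
  have hmono : Monotone g := fun s t hst =>
    Real.smoothTransition.monotone (mul_le_mul_of_nonneg_left (by linarith) hpos.le)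
  have hgc : HasCompactSupport (deriv g) := by
    refine HasCompactSupport.intro (isCompact_Icc (a := ℓ q) (b := ℓ p)) fun t ht => ?_
    rw [Set.mem_Icc, not_and_or, not_le, not_le] at ht
    rcases ht with ht | ht
    · have : g =ᶠ[nhds t] fun _ => 0 := by
        filter_upwards [Iio_mem_nhds ht] with s hs
        exact Real.smoothTransition.zero_of_nonpos
          (mul_nonpos_of_nonneg_of_nonpos hpos.le (by linarith [Set.mem_Iio.1 hs]))
      rw [this.deriv_eq, deriv_const]
    · have : g =ᶠ[nhds t] fun _ => 1 := by
        filter_upwards [Ioi_mem_nhds ht] with s hs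
        refine Real.smoothTransition.one_of_one_le ?_
        rw [← inv_mul_cancel₀ (sub_pos.2 hlt).ne']
        exact mul_le_mul_of_nonneg_left (by linarith [Set.mem_Ioi.1 hs]) hpos.le
      rw [this.deriv_eq, deriv_const]
  have hgd : ∀ x, HasFDerivAt (fun x => g (ℓ x)) (deriv g (ℓ x) • ℓ) x := fun x =>
    ((hg.differentiable (by simp) (ℓ x)).hasDerivAt).comp_hasFDerivAt x ℓ.hasFDerivAt
  have hd0 : ∀ t, 0 ≤ deriv g t := fun t => hmono.deriv_nonneg
  have hP : ∀ x, 0 ≤ fderiv ℝ (fun x => g (ℓ x)) x (1, 1) := fun x => by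
    rw [(hgd x).fderiv]; exact mul_nonneg (hd0 _) hp
  have hQ : ∀ x, 0 ≤ fderiv ℝ (fun x => g (ℓ x)) x (1, -1) := fun x => by
    rw [(hgd x).fderiv]; exact mul_nonneg (hd0 _) hm
  have hmem := testFunction_mem_causalCone (d₁ := d₁) (d₂ := d₂) (A := fun x => g (ℓ x))
    (B := fun _ => 0) (e := 1) (comp_linear_mem_scalarAlgebra hg hgc hmono hp hm)
    (fun x => (hgd x).differentiableAt) contDiff_const HasCompactSupport.zero 1 1 (by simp)
    (by simpa using hP) (by simpa using hP) (by simpa using hQ) (by simpa using hQ)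
    (by simpa using fun x => mul_nonneg (hP x) (hQ x))
    (by simpa using fun x => mul_nonneg (hP x) (hQ x))
  have hle := h _ hmem
  have hgp : g (ℓ p) = 1 := by
    simp only [g]
    rw [inv_mul_cancel₀ (sub_pos.2 hlt).ne', Real.smoothTransition.one]
  have hgq : g (ℓ q) = 0 := by simp [g]
  simp only [blochValue_testFunction, hgp, hgq] at hle
  linarith

/-! ### Profiles of the extremal elements of the causal cone -/

theorem exists_slow_cutoff {ε : ℝ} (hε : 0 < ε) (R : ℝ) :
    ∃ χ : ℝ → ℝ, ContDiff ℝ ∞ χ ∧ HasCompactSupport χ ∧ (∀ s, 0 ≤ χ s) ∧ (∀ s, χ s ≤ 1) ∧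
      (∀ s, |deriv χ s| ≤ ε) ∧ ∀ s, |s| ≤ R → χ s = 1 := by
  let f : ContDiffBump (0 : ℝ) := ⟨1, 2, by norm_num, by norm_num⟩
  have hf : ContDiff ℝ ∞ f := f.contDiff
  obtain ⟨K, hK⟩ := (hf.continuous_deriv (by simp)).bounded_above_of_compact_support
    f.hasCompactSupport.deriv
  have hK0 : 0 ≤ K := (norm_nonneg _).trans (hK 0)
  have hden : 0 < K / ε + |R| + 1 := by positivity
  -- The bump is stretched by `1 / c`: the term `K / ε` makes the slope at most `ε`, and `|R|` keeps
  -- `[-R, R]` where the bump equals `1`.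
  set c := (K / ε + |R| + 1)⁻¹ with hc
  have hc0 : 0 < c := inv_pos.2 hden
  refine ⟨fun s => f (c • s), hf.comp (contDiff_const_smul c),
    f.hasCompactSupport.comp_smul hc0.ne', fun s => f.nonneg, fun s => f.le_one, fun s => ?_,
    fun s hs => ?_⟩
  · have hd : HasDerivAt (fun s => f (c • s)) (deriv f (c • s) * c) s := by
      have h1 : HasDerivAt (fun s : ℝ => c • s) c s := by simpa using (hasDerivAt_id s).const_mul c
      exact ((hf.differentiable (by simp) (c • s)).hasDerivAt).comp s h1
    rw [hd.deriv, abs_mul, abs_of_pos hc0]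
    refine (mul_le_mul_of_nonneg_right (hK _) hc0.le).trans ?_
    rw [hc, ← div_eq_mul_inv, div_le_iff₀ hden]
    have : ε * (K / ε) = K := mul_div_cancel₀ K hε.ne'
    nlinarith [abs_nonneg R]
  · refine f.one_of_mem_closedBall ?_
    rw [mem_closedBall_zero_iff, norm_smul, Real.norm_eq_abs, Real.norm_eq_abs, abs_of_pos hc0]
    change c * |s| ≤ 1
    rw [hc, ← div_eq_inv_mul, div_le_one hden]
    have := div_nonneg hK0 hε.le
    linarith [le_abs_self R]

/-- For `b = 1/sin(β - Dt)` the root of `b'² + D²b²` is exactly `D/sin²`, the derivative of `cot(β -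
Dt)`. This is why the pair (cotangent, cosecant) saturates the cone condition; `η` is the price of
smoothing the root. -/
theorem sqrt_deriv_inv_sin {S C D η : ℝ} (hS : 0 < S) (hD : 0 ≤ D) (hη : 0 ≤ η)
    (h : S ^ 2 + C ^ 2 = 1) :
    √((D * C / S ^ 2) ^ 2 + D ^ 2 * (1 / S) ^ 2 + η ^ 2) ≤ D / S ^ 2 + η := by
  refine Real.sqrt_le_iff.2 ⟨by positivity, ?_⟩
  have : (D * C / S ^ 2) ^ 2 + D ^ 2 * (1 / S) ^ 2 = (D / S ^ 2) ^ 2 := by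
    field_simp
    linear_combination D ^ 2 * h
  rw [this]
  have : 0 ≤ D / S ^ 2 * η := by positivity
  nlinarith

/-- A globally smooth version of the pair `1/sin`, `cot` on `[t₀, t₁]`. The surplus `ε * |b|` leaves
room for a slow cutoff in the transverse direction, and `δ` bounds the excess growth of `G`. -/
theorem exists_profile {D t₀ t₁ β δ : ℝ} (hD : 0 ≤ D) (ht : t₀ ≤ t₁) (h₁ : 0 < β - D * t₁)
    (h₀ : β - D * t₀ < Real.pi) (hδ : 0 < δ) :
    ∃ (b G : ℝ → ℝ) (ε : ℝ), 0 < ε ∧ ContDiff ℝ ∞ b ∧ HasCompactSupport b ∧ ContDiff ℝ ∞ G ∧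
      HasCompactSupport (deriv G) ∧
      (∀ t, √(deriv b t ^ 2 + D ^ 2 * b t ^ 2) + ε * |b t| ≤ deriv G t) ∧
      b t₀ = 1 / Real.sin (β - D * t₀) ∧ b t₁ = 1 / Real.sin (β - D * t₁) ∧
      G t₁ - G t₀ ≤ Real.cos (β - D * t₁) / Real.sin (β - D * t₁) -
        Real.cos (β - D * t₀) / Real.sin (β - D * t₀) + δ := by
  -- The margin by which the angles on `[t₀, t₁]` avoid `0` and `π`; it allows an enlargement by `2
  -- * κ` on which the sine stays positive.
  set m := min (Real.pi - (β - D * t₀)) (β - D * t₁) with hm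
  have hm0 : 0 < m := lt_min (by linarith) h₁
  obtain ⟨κ, hκ0, hκ⟩ : ∃ κ : ℝ, 0 < κ ∧ D * (2 * κ) < m := by
    refine ⟨m / (4 * (D + 1)), by positivity, ?_⟩
    rw [show D * (2 * (m / (4 * (D + 1)))) = m * (D / (2 * (D + 1))) by field_simp; ring]
    have : D / (2 * (D + 1)) < 1 := by rw [div_lt_one (by positivity)]; linarith
    nlinarith
  have hm1 : m ≤ Real.pi - (β - D * t₀) := min_le_left _ _
  have hm2 : m ≤ β - D * t₁ := min_le_right _ _
  set o := (t₀ + t₁) / 2 with ho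
  set R := (t₁ - t₀) / 2 with hR
  have hR0 : 0 ≤ R := by rw [hR]; linarith
  have hsin : ∀ t ∈ Metric.closedBall o (R + 2 * κ), 0 < Real.sin (β - D * t) := by
    intro t htm
    rw [Metric.mem_closedBall, Real.dist_eq, abs_le] at htm
    have e1 : t₀ - 2 * κ ≤ t := by linarith [htm.1]
    have e2 : t ≤ t₁ + 2 * κ := by linarith [htm.2]
    have := mul_le_mul_of_nonneg_left e1 hD
    have := mul_le_mul_of_nonneg_left e2 hD
    exact Real.sin_pos_of_pos_of_lt_pi (by linarith) (by linarith)
  -- Nested radii: `ψ` is `1` on a neighbourhood of `[t₀, t₁]`, so `b` has the exact value and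
  -- derivative there, and `φ` is `1` on the support of `ψ`, so the bound on `b` survives the
  -- truncation of `G'`.
  let ψ : ContDiffBump o := ⟨R + κ, R + 2 * κ, by linarith, by linarith⟩
  let φ : ContDiffBump o := ⟨R + 2 * κ, R + 3 * κ, by linarith, by linarith⟩
  let b : ℝ → ℝ := fun t => ψ t * (1 / Real.sin (β - D * t))
  have hψs : tsupport ψ = Metric.closedBall o (R + 2 * κ) := ψ.tsupport_eq
  have hbs : tsupport b ⊆ Metric.closedBall o (R + 2 * κ) := by
    rw [← hψs]
    exact tsupport_mul_subset_left
  have hang : ContDiff ℝ ∞ fun t => Real.sin (β - D * t) :=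
    Real.contDiff_sin.comp (contDiff_const.sub (contDiff_const.mul contDiff_id))
  have hb : ContDiff ℝ ∞ b := by
    rw [contDiff_iff_contDiffAt]
    intro t
    by_cases htm : t ∈ tsupport ψ
    · exact ψ.contDiffAt.mul (contDiffAt_const.div hang.contDiffAt (hsin t (hψs ▸ htm)).ne')
    · have : b =ᶠ[nhds t] fun _ => 0 := by
        filter_upwards [(notMem_tsupport_iff_eventuallyEq.1 htm)] with s hs
        simp only [b, hs, Pi.zero_apply, zero_mul]
      exact contDiffAt_const.congr_of_eventuallyEq this
  have hbc : HasCompactSupport b := ψ.hasCompactSupport.mul_right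
  have hb' : ContDiff ℝ ∞ (deriv b) := (contDiff_infty_iff_deriv.1 hb).2
  obtain ⟨K, hK⟩ := hb.continuous.bounded_above_of_compact_support hbc
  have hK0 : 0 ≤ K := (norm_nonneg _).trans (hK 0)
  set η := δ / (2 * (t₁ - t₀) + 1) with hη
  have hηd : 0 < 2 * (t₁ - t₀) + 1 := by linarith
  have hη0 : 0 < η := div_pos hδ hηd
  -- The inner `η ^ 2` makes the root smooth, while the outer `η` pays for `ε * |b|`. Together they
  -- cost at most `2 * η` per unit of `t`, hence the choice of `η`.
  let g : ℝ → ℝ := fun t => φ t * (√(deriv b t ^ 2 + D ^ 2 * b t ^ 2 + η ^ 2) + η)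
  have hg : ContDiff ℝ ∞ g := by
    refine φ.contDiff.mul (ContDiff.add (ContDiff.sqrt ?_ fun t => ?_) contDiff_const)
    · exact ((hb'.pow 2).add (contDiff_const.mul (hb.pow 2))).add contDiff_const
    · positivity
  have hgc : HasCompactSupport g := φ.hasCompactSupport.mul_right
  let G : ℝ → ℝ := fun t => ∫ u in (0 : ℝ)..t, g u
  have hGd : ∀ t, HasDerivAt G (g t) t := fun t =>
    (hg.continuous.integral_hasStrictDerivAt 0 t).hasDerivAt
  have hG' : deriv G = g := funext fun t => (hGd t).deriv
  have hnear : ∀ t ∈ Set.Icc t₀ t₁, t ∈ Metric.ball o (R + κ) := fun t ht => by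
    rw [Metric.mem_ball, Real.dist_eq, abs_lt]
    constructor <;> linarith [ht.1, ht.2]
  have hnear' : ∀ t ∈ Set.Icc t₀ t₁, t ∈ Metric.closedBall o (R + 2 * κ) := fun t ht =>
    Metric.ball_subset_closedBall (Metric.ball_subset_ball (by linarith) (hnear t ht))
  have hbv : ∀ t ∈ Set.Icc t₀ t₁, b t = 1 / Real.sin (β - D * t) := fun t ht => by
    have : ψ t = 1 := ψ.one_of_mem_closedBall (Metric.ball_subset_closedBall (hnear t ht))
    simp only [b, this, one_mul]
  have hlin : ∀ t, HasDerivAt (fun t => β - D * t) (-D) t := fun t => by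
    simpa using ((hasDerivAt_id t).const_mul D).const_sub β
  have hbd : ∀ t ∈ Set.Icc t₀ t₁,
      deriv b t = D * Real.cos (β - D * t) / Real.sin (β - D * t) ^ 2 := fun t ht => by
    have hS := hsin t (hnear' t ht)
    have he : b =ᶠ[nhds t] fun t => (Real.sin (β - D * t))⁻¹ := by
      filter_upwards [ψ.eventuallyEq_one_of_mem_ball (hnear t ht)] with s hs
      simp only [b, hs, Pi.one_apply, one_mul, one_div]
    rw [he.deriv_eq, ((hlin t).sin.fun_inv hS.ne').deriv]
    ring
  refine ⟨b, G, η / (K + 1), by positivity, hb, hbc,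
    contDiff_infty_iff_deriv.2 ⟨fun t => (hGd t).differentiableAt, hG' ▸ hg⟩, hG' ▸ hgc, fun t => ?_,
    hbv t₀ ⟨le_rfl, ht⟩, hbv t₁ ⟨ht, le_rfl⟩, ?_⟩
  · rw [hG']
    by_cases htm : t ∈ tsupport b
    · have hφ : φ t = 1 := φ.one_of_mem_closedBall (hbs htm)
      simp only [g, hφ, one_mul]
      refine add_le_add (Real.sqrt_le_sqrt (by nlinarith)) ?_
      have := hK t
      rw [Real.norm_eq_abs] at this
      rw [div_mul_eq_mul_div, div_le_iff₀ (by positivity)]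
      nlinarith
    · have e1 : b t = 0 := image_eq_zero_of_notMem_tsupport htm
      have e2 : deriv b t = 0 := by
        by_contra h
        exact htm (support_deriv_subset h)
      rw [e1, e2]
      have : 0 ≤ g t := mul_nonneg φ.nonneg (add_nonneg (Real.sqrt_nonneg _) hη0.le)
      simpa using this
  · let H : ℝ → ℝ := fun t =>
      G t - (Real.cos (β - D * t) / Real.sin (β - D * t)) - 2 * η * t
    have hHd : ∀ t ∈ Set.Icc t₀ t₁, HasDerivAt H
        (g t - D / Real.sin (β - D * t) ^ 2 - 2 * η) t := fun t ht => by
      have hS := hsin t (hnear' t ht)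
      have hcot : HasDerivAt (fun t => Real.cos (β - D * t) / Real.sin (β - D * t))
          (D / Real.sin (β - D * t) ^ 2) t := by
        refine ((hlin t).cos.fun_div (hlin t).sin hS.ne').congr_deriv ?_
        congr 1
        linear_combination D * Real.sin_sq_add_cos_sq (β - D * t)
      have hid : HasDerivAt (fun t => 2 * η * t) (2 * η) t := by
        simpa using (hasDerivAt_id t).const_mul (2 * η)
      exact ((hGd t).sub hcot).sub hid
    have hanti : AntitoneOn H (Set.Icc t₀ t₁) := by
      refine antitoneOn_of_deriv_nonpos (convex_Icc _ _)
        (fun t ht => (hHd t ht).continuousAt.continuousWithinAt)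
        (fun t ht => (hHd t (interior_subset ht)).differentiableAt.differentiableWithinAt)
        fun t ht' => ?_
      have ht : t ∈ Set.Icc t₀ t₁ := interior_subset ht'
      rw [(hHd t ht).deriv]
      have hφ : φ t = 1 := φ.one_of_mem_closedBall (hnear' t ht)
      simp only [g, hφ, one_mul, hbd t ht, hbv t ht]
      have := sqrt_deriv_inv_sin (hsin t (hnear' t ht)) hD hη0.le
        (Real.sin_sq_add_cos_sq (β - D * t))
      linarith
    have := hanti ⟨le_rfl, ht⟩ ⟨ht, le_rfl⟩ ht
    simp only [H] at this
    have hle : 2 * η * (t₁ - t₀) ≤ δ := by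
      have : η * (2 * (t₁ - t₀) + 1) = δ := div_mul_cancel₀ _ hηd.ne'
      nlinarith
    linarith

/-! ### Boosted coordinates and the lower bound on proper time -/

/-- The linear coordinate `k x⁰ + l x¹`. -/
def linearCoord (k l : ℝ) : Minkowski →L[ℝ] ℝ :=
  k • ContinuousLinearMap.fst ℝ ℝ ℝ + l • ContinuousLinearMap.snd ℝ ℝ ℝ

theorem linearCoord_apply (k l : ℝ) (x : Minkowski) : linearCoord k l x = k * x.1 + l * x.2 := rfl

/-- The arithmetic-geometric mean inequality is an equality at `l = √(v / u)`: some boost makes the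
elapsed coordinate time equal to the proper distance. Shifting `u` and `v` by a small `ε` covers
null separations at the cost of strictness. -/
theorem exists_boost {D K u v : ℝ} (hD : 0 ≤ D) (hu : 0 ≤ u) (hv : 0 ≤ v)
    (h : D * √(u * v) < K) : ∃ l : ℝ, 0 < l ∧ D * ((l * u + l⁻¹ * v) / 2) < K := by
  have hc : Continuous fun ε : ℝ => D * √((u + ε) * (v + ε)) := by fun_prop
  have h0 : ∀ᶠ ε in nhds (0 : ℝ), D * √((u + ε) * (v + ε)) < K :=
    hc.continuousAt.eventually_lt continuousAt_const (by simpa using h)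
  obtain ⟨ε, hε, hε0⟩ := ((h0.filter_mono nhdsWithin_le_nhds).and
    (self_mem_nhdsWithin (s := Set.Ioi (0 : ℝ)))).exists
  have hu' : 0 < √(u + ε) := Real.sqrt_pos.2 (by linarith)
  have hv' : 0 < √(v + ε) := Real.sqrt_pos.2 (by linarith)
  refine ⟨√(v + ε) / √(u + ε), by positivity, lt_of_le_of_lt ?_ hε⟩
  refine mul_le_mul_of_nonneg_left ?_ hD
  rw [Real.sqrt_mul (by linarith), inv_div]
  have e1 : √(v + ε) / √(u + ε) * u ≤ √(u + ε) * √(v + ε) := by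
    rw [div_mul_eq_mul_div, div_le_iff₀ hu']
    nlinarith [Real.sq_sqrt (show 0 ≤ u + ε by linarith)]
  have e2 : √(u + ε) / √(v + ε) * v ≤ √(u + ε) * √(v + ε) := by
    rw [div_mul_eq_mul_div, div_le_iff₀ hv']
    nlinarith [Real.sq_sqrt (show 0 ≤ v + ε by linarith)]
  linarith

/-- The surplus `ε * |b|` in `g` absorbs the derivative of the cutoff, and the rest is `g² - b'² ≥
d²b²` scaled by `χ ≤ 1`. -/
theorem profile_inequality {d b b' g χ χ' ε : ℝ}
    (hg : √(b' ^ 2 + |d| ^ 2 * b ^ 2) + ε * |b| ≤ g) (h0 : 0 ≤ χ) (h1 : χ ≤ 1) (hχ' : |χ'| ≤ ε) :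
    0 ≤ g - b' * χ - b * χ' ∧ 0 ≤ g + b' * χ - b * χ' ∧
      (d * (b * χ)) ^ 2 ≤ (g - b' * χ - b * χ') * (g + b' * χ - b * χ') := by
  set S := √(b' ^ 2 + |d| ^ 2 * b ^ 2) with hS
  have hSn : 0 ≤ S := Real.sqrt_nonneg _
  have hS2 : S ^ 2 = b' ^ 2 + d ^ 2 * b ^ 2 := by
    rw [hS, Real.sq_sqrt (by positivity), sq_abs]
  have hb : |b'| ≤ S := Real.abs_le_sqrt (by nlinarith [sq_nonneg (|d| * b)])
  have h2 : b * χ' ≤ ε * |b| := by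
    refine (le_abs_self _).trans ?_
    rw [abs_mul, mul_comm]
    exact mul_le_mul_of_nonneg_right hχ' (abs_nonneg _)
  have h3 : S * χ ≤ g - b * χ' := by nlinarith
  have h4 : |b' * χ| ≤ S * χ := by
    rw [abs_mul, abs_of_nonneg h0]
    exact mul_le_mul_of_nonneg_right hb h0
  obtain ⟨h5, h6⟩ := abs_le.1 h4
  refine ⟨by linarith, by linarith, ?_⟩
  have h7 : (S * χ) ^ 2 ≤ (g - b * χ') ^ 2 := pow_le_pow_left₀ (mul_nonneg hSn h0) h3 2
  rw [mul_pow, hS2] at h7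
  linarith

theorem lightCone_of_blochValue_le {d₁ d₂ : ℝ} {p q : Minkowski} {z z' : ℝ} {c c' : ℂ}
    (h : ∀ a ∈ causalCone d₁ d₂, blochValue (a.1 p) z c ≤ blochValue (a.1 q) z' c') :
    0 ≤ q.1 - p.1 + (q.2 - p.2) ∧ 0 ≤ q.1 - p.1 - (q.2 - p.2) := by
  constructor
  · have := linear_le_of_blochValue_le h (ℓ := linearCoord 1 1) (by norm_num [linearCoord_apply])
      (by norm_num [linearCoord_apply])
    simp only [linearCoord_apply] at this
    linarith
  · have := linear_le_of_blochValue_le h (ℓ := linearCoord 1 (-1))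
      (by norm_num [linearCoord_apply]) (by norm_num [linearCoord_apply])
    simp only [linearCoord_apply] at this
    linarith

theorem arccos_le_of_blochValue_le {d₁ d₂ : ℝ} {p q : Minkowski} {z : ℝ} {w w' : ℂ}
    (hz : z ^ 2 < 1)
    (h : ∀ a ∈ causalCone d₁ d₂, blochValue (a.1 p) z (√(1 - z ^ 2) * w) ≤
      blochValue (a.1 q) z (√(1 - z ^ 2) * w')) {e : ℂ} (he : ‖e‖ = 1)
    (hw : |(w * e).re| ≤ 1) (hw' : |(w' * e).re| ≤ 1) :
    Real.arccos (w * e).re ≤ Real.arccos (w' * e).re +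
      |d₁ - d₂| * √((q.1 - p.1 + (q.2 - p.2)) * (q.1 - p.1 - (q.2 - p.2))) := by
  set x := (w * e).re with hx
  set y := (w' * e).re with hy
  set D := |d₁ - d₂| with hD
  have hD0 : 0 ≤ D := abs_nonneg _
  obtain ⟨hu, hv⟩ := lightCone_of_blochValue_le h
  by_contra! hlt
  obtain ⟨l, hl, hlK⟩ := exists_boost (K := Real.arccos x - Real.arccos y) hD0 hu hv (by linarith)
  set τ := linearCoord ((l + l⁻¹) / 2) ((l - l⁻¹) / 2) with hτ
  set σ := linearCoord ((l - l⁻¹) / 2) ((l + l⁻¹) / 2) with hσ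
  have hτp : τ (1, 1) = l := by rw [hτ, linearCoord_apply]; ring
  have hτm : τ (1, -1) = l⁻¹ := by rw [hτ, linearCoord_apply]; ring
  have hσp : σ (1, 1) = l := by rw [hσ, linearCoord_apply]; ring
  have hσm : σ (1, -1) = -l⁻¹ := by rw [hσ, linearCoord_apply]; ring
  have hdiff : τ q - τ p =
      (l * (q.1 - p.1 + (q.2 - p.2)) + l⁻¹ * (q.1 - p.1 - (q.2 - p.2))) / 2 := by
    rw [hτ, linearCoord_apply, linearCoord_apply]; ring
  have hle : τ p ≤ τ q := by
    rw [← sub_nonneg, hdiff]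
    have : 0 < l⁻¹ := inv_pos.2 hl
    positivity
  rw [← hdiff] at hlK
  -- the angle at `q` lies strictly between the two bounds
  obtain ⟨ϑ, hϑ1, hϑ2⟩ : ∃ ϑ, Real.arccos y < ϑ ∧ ϑ + D * (τ q - τ p) < Real.arccos x :=
    ⟨(Real.arccos y + (Real.arccos x - D * (τ q - τ p))) / 2, by linarith, by linarith⟩
  -- With this offset the angle of the profile exceeds `arccos y` at `q` and is below `arccos x` at
  -- `p`, so the test element has opposite signs there.
  set β := ϑ + D * τ q with hβ
  have hβ1 : β - D * τ q = ϑ := by rw [hβ]; ring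
  have hβ0 : β - D * τ p = ϑ + D * (τ q - τ p) := by rw [hβ]; ring
  have hϑ0 : 0 < ϑ := (Real.arccos_nonneg y).trans_lt hϑ1
  have hprod : 0 ≤ D * (τ q - τ p) := mul_nonneg hD0 (sub_nonneg.2 hle)
  have hπ : ϑ + D * (τ q - τ p) < Real.pi := hϑ2.trans_le (Real.arccos_le_pi x)
  have hcos0 : x < Real.cos (β - D * τ p) := by
    rw [hβ0]
    have := Real.cos_lt_cos_of_nonneg_of_le_pi (by linarith) (Real.arccos_le_pi x) hϑ2
    rwa [Real.cos_arccos (abs_le.1 hw).1 (abs_le.1 hw).2] at this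
  have hcos1 : Real.cos (β - D * τ q) < y := by
    rw [hβ1]
    have := Real.cos_lt_cos_of_nonneg_of_le_pi (Real.arccos_nonneg y) (by linarith) hϑ1
    rwa [Real.cos_arccos (abs_le.1 hw').1 (abs_le.1 hw').2] at this
  have hsin0 : 0 < Real.sin (β - D * τ p) := by
    rw [hβ0]; exact Real.sin_pos_of_pos_of_lt_pi (by linarith) hπ
  have hsin1 : 0 < Real.sin (β - D * τ q) := by
    rw [hβ1]; exact Real.sin_pos_of_pos_of_lt_pi hϑ0 (by linarith)
  -- The allowed error is the whole positive value of the ideal element at `p`; the strictly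
  -- negative value at `q` still gives a contradiction.
  set δ := (Real.cos (β - D * τ p) - x) / Real.sin (β - D * τ p) with hδ
  have hδ0 : 0 < δ := div_pos (sub_pos.2 hcos0) hsin0
  obtain ⟨b, G, ε, hε, hb, hbc, hG, hGc, hbG, hbp, hbq, hGle⟩ :=
    exists_profile (D := D) (t₀ := τ p) (t₁ := τ q) (β := β) hD0 hle (by rw [hβ1]; exact hϑ0)
      (by rw [hβ0]; exact hπ) hδ0
  obtain ⟨χ, hχ, hχc, hχ0, hχ1, hχ', hχe⟩ := exists_slow_cutoff hε (max |σ p| |σ q|)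
  have hGmono : Monotone G := monotone_of_deriv_nonneg (hG.differentiable (by simp)) fun t =>
    le_trans (add_nonneg (Real.sqrt_nonneg _) (mul_nonneg hε.le (abs_nonneg _))) (hbG t)
  have hlinv : 0 < l⁻¹ := inv_pos.2 hl
  have hA := comp_linear_mem_scalarAlgebra hG hGc hGmono (ℓ := τ) (by rw [hτp]; exact hl.le)
    (by rw [hτm]; exact hlinv.le)
  have hAd : ∀ x, HasFDerivAt (fun x => G (τ x)) (deriv G (τ x) • τ) x := fun x =>
    ((hG.differentiable (by simp) (τ x)).hasDerivAt).comp_hasFDerivAt x τ.hasFDerivAt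
  let B : Minkowski → ℝ := fun x => b (τ x) * χ (σ x)
  have hB : ContDiff ℝ ∞ B := (hb.comp τ.contDiff).mul (hχ.comp σ.contDiff)
  have hBd : ∀ x, HasFDerivAt B
      (b (τ x) • (deriv χ (σ x) • σ) + χ (σ x) • (deriv b (τ x) • τ)) x := fun x =>
    (((hb.differentiable (by simp) (τ x)).hasDerivAt).comp_hasFDerivAt x τ.hasFDerivAt).mul
      (((hχ.differentiable (by simp) (σ x)).hasDerivAt).comp_hasFDerivAt x σ.hasFDerivAt)
  have hBc : HasCompactSupport B := by
    -- The inverse of the linear coordinates `(τ, σ)`; it carries the product of the two supports to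
    -- a compact set.
    let Φ : ℝ × ℝ → Minkowski := fun y => ((l⁻¹ * (y.1 + y.2) + l * (y.1 - y.2)) / 2,
      (l⁻¹ * (y.1 + y.2) - l * (y.1 - y.2)) / 2)
    have hΦ : Continuous Φ := by fun_prop
    have hΦi : ∀ x, Φ (τ x, σ x) = x := fun x => by
      have hll : l⁻¹ * l = 1 := inv_mul_cancel₀ hl.ne'
      simp only [Φ, hτ, hσ, linearCoord_apply]
      ext
      · simp only
        linear_combination x.1 * hll
      · simp only
        linear_combination x.2 * hll
    have hK : IsCompact (Set.image Φ (tsupport b ×ˢ tsupport χ)) := (hbc.prod hχc).image hΦ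
    refine HasCompactSupport.intro hK fun x hx => ?_
    by_contra hne
    refine hx ⟨(τ x, σ x), ⟨subset_tsupport _ ?_, subset_tsupport _ ?_⟩, hΦi x⟩
    · exact left_ne_zero_of_mul hne
    · exact right_ne_zero_of_mul hne
  have hin := fun x => profile_inequality (d := d₁ - d₂) (hbG (τ x)) (hχ0 (σ x)) (hχ1 (σ x))
    (hχ' (σ x))
  have hin' := fun x => profile_inequality (d := d₁ - d₂) (hbG (τ x)) (hχ0 (σ x)) (hχ1 (σ x))
    (χ' := -deriv χ (σ x)) (by rw [abs_neg]; exact hχ' (σ x))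
  have hAp : ∀ x, fderiv ℝ (fun x => G (τ x)) x (1, 1) = l * deriv G (τ x) := fun x => by
    rw [(hAd x).fderiv]; simp [hτp, mul_comm]
  have hAm : ∀ x, fderiv ℝ (fun x => G (τ x)) x (1, -1) = l⁻¹ * deriv G (τ x) := fun x => by
    rw [(hAd x).fderiv]; simp [hτm, mul_comm]
  have hBp : ∀ x, fderiv ℝ B x (1, 1) =
      l * (deriv b (τ x) * χ (σ x) + b (τ x) * deriv χ (σ x)) := fun x => by
    rw [(hBd x).fderiv]
    simp [hτp, hσp]
    ring
  have hBm : ∀ x, fderiv ℝ B x (1, -1) =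
      l⁻¹ * (deriv b (τ x) * χ (σ x) - b (τ x) * deriv χ (σ x)) := fun x => by
    rw [(hBd x).fderiv]
    simp [hτm, hσm]
    ring
  have hll : l * l⁻¹ = 1 := mul_inv_cancel₀ hl.ne'
  have hz' := abs_lt.1 ((sq_lt_one_iff_abs_lt_one z).1 hz)
  have hzp : 0 < √(1 + z) := Real.sqrt_pos.2 (by linarith [hz'.1])
  have hzm : 0 < √(1 - z) := Real.sqrt_pos.2 (by linarith [hz'.2])
  -- These weights cancel the latitude: the coefficient of `A` becomes `1`, and `√(1 - z ^ 2)` drops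
  -- out of the coefficient of `B`.
  have hmem := testFunction_mem_causalCone (d₁ := d₁) (d₂ := d₂) hA
    (fun x => (hAd x).differentiableAt) hB hBc (√(1 + z))⁻¹ (√(1 - z))⁻¹ he
    (fun x => by
      rw [hAp, hBp, ← mul_sub]
      exact mul_nonneg hl.le (by linarith [(hin x).1]))
    (fun x => by
      rw [hAp, hBp, ← mul_add]
      exact mul_nonneg hl.le (by linarith [(hin' x).2.1]))
    (fun x => by
      rw [hAm, hBm, ← mul_sub]
      exact mul_nonneg hlinv.le (by linarith [(hin' x).1]))
    (fun x => by
      rw [hAm, hBm, ← mul_add]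
      exact mul_nonneg hlinv.le (by linarith [(hin x).2.1]))
    (fun x => by
      rw [hAp, hBp, hAm, hBm]
      refine (hin x).2.2.trans_eq ?_
      linear_combination -((deriv G (τ x) - deriv b (τ x) * χ (σ x) - b (τ x) * deriv χ (σ x)) *
        (deriv G (τ x) + deriv b (τ x) * χ (σ x) - b (τ x) * deriv χ (σ x))) * hll)
    (fun x => by
      rw [hAp, hBp, hAm, hBm]
      refine (hin' x).2.2.trans_eq ?_
      linear_combination -((deriv G (τ x) + deriv b (τ x) * χ (σ x) + b (τ x) * deriv χ (σ x)) *
        (deriv G (τ x) - deriv b (τ x) * χ (σ x) + b (τ x) * deriv χ (σ x))) * hll)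
  have hfin := h _ hmem
  simp only [blochValue_testFunction] at hfin
  have hcoef : (1 + z) / 2 * (√(1 + z))⁻¹ ^ 2 + (1 - z) / 2 * (√(1 - z))⁻¹ ^ 2 = 1 := by
    rw [inv_pow, inv_pow, Real.sq_sqrt (by linarith [hz'.1]), Real.sq_sqrt (by linarith [hz'.2])]
    have : 1 + z ≠ 0 := by linarith [hz'.1]
    have : 1 - z ≠ 0 := by linarith [hz'.2]
    field_simp
    norm_num
  have hN : ∀ (B : ℝ) (v : ℂ), (√(1 + z))⁻¹ * (√(1 - z))⁻¹ * B * (√(1 - z ^ 2) * v * e).re =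
      B * (v * e).re := fun B v => by
    rw [mul_assoc (_ : ℂ), Complex.re_ofReal_mul, show 1 - z ^ 2 = (1 + z) * (1 - z) by ring,
      Real.sqrt_mul (by linarith [hz'.1])]
    field_simp
  rw [hcoef, hN, hN, ← hx, ← hy] at hfin
  simp only [B, hχe (σ p) (le_max_left _ _), hχe (σ q) (le_max_right _ _), hbp, hbq, mul_one,
    one_mul] at hfin
  have hneg : (Real.cos (β - D * τ q) - y) / Real.sin (β - D * τ q) < 0 :=
    div_neg_of_neg_of_pos (sub_neg.2 hcos1) hsin1
  rw [sub_div] at hneg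
  have hδ' : δ = Real.cos (β - D * τ p) / Real.sin (β - D * τ p) -
      x / Real.sin (β - D * τ p) := by rw [hδ, sub_div]
  rw [one_div_mul_eq_div, one_div_mul_eq_div] at hfin
  linarith

/-! ### Straight causal curves -/

theorem exists_straight_causalCurve {p q : Minkowski} (hu : 0 ≤ q.1 - p.1 + (q.2 - p.2))
    (hv : 0 ≤ q.1 - p.1 - (q.2 - p.2)) :
    ∃ (γ : ℝ → Minkowski) (T : ℝ), IsCausalCurve γ T ∧ γ 0 = p ∧ γ T = q ∧
      properTime γ T = √((q.1 - p.1 + (q.2 - p.2)) * (q.1 - p.1 - (q.2 - p.2))) := by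
  rcases (show 0 ≤ q.1 - p.1 by linarith).eq_or_lt with h0 | h0
  · have h1 : q.2 - p.2 = 0 := by linarith
    have hpq : p = q := Prod.ext (by linarith) (by linarith)
    refine ⟨fun _ => p, 0, ⟨le_rfl, contDiffOn_const, fun h => absurd h (lt_irrefl 0)⟩, rfl, hpq, ?_⟩
    rw [← h0, h1]
    simp [properTime]
  · have hvel : ∀ t ∈ Set.Icc (0 : ℝ) 1,
        velocity (fun t => p + t • (q - p)) 1 t = q - p := by
      intro t ht
      have : HasDerivAt (fun t : ℝ => p + t • (q - p)) (q - p) t := by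
        simpa using ((hasDerivAt_id t).smul_const (q - p)).const_add p
      exact this.hasDerivWithinAt.derivWithin (uniqueDiffOn_Icc zero_lt_one t ht)
    have hmet : -metric (q - p) (q - p) =
        (q.1 - p.1 + (q.2 - p.2)) * (q.1 - p.1 - (q.2 - p.2)) := by
      simp only [metric, Prod.fst_sub, Prod.snd_sub]
      ring
    refine ⟨fun t => p + t • (q - p), 1, ⟨zero_le_one, ?_, fun _ t ht => ?_⟩, by simp, by simp, ?_⟩
    · exact (contDiff_const.add (contDiff_id.smul contDiff_const)).contDiffOn
    · rw [hvel t ht]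
      refine ⟨?_, h0⟩
      have := mul_nonneg hu hv
      rw [← hmet] at this
      linarith
    · have : properTime (fun t => p + t • (q - p)) 1 =
          ∫ _ in (0 : ℝ)..1, √(-metric (q - p) (q - p)) := by
        refine intervalIntegral.integral_congr fun t ht => ?_
        rw [Set.uIcc_of_le zero_le_one] at ht
        simp only [hvel t ht]
      rw [this, hmet]
      simp

/-! ### Bloch vectors of density matrices -/

/-- The Bloch vector `(re c, im c, z)`. -/
def blochVector (z : ℝ) (c : ℂ) : EuclideanSpace ℝ (Fin 3) := !₂[c.re, c.im, z]

theorem sq_add_sq_le_of_eq_blochMatrix {ρ : DensityMatrix} {r : EuclideanSpace ℝ (Fin 3)}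
    (hρ : ρ.1 = blochMatrix r) : r 0 ^ 2 + r 1 ^ 2 ≤ 1 - r 2 ^ 2 := by
  have h := (Complex.le_def.1 ρ.2.1.det_nonneg).1
  rw [hρ, Matrix.det_fin_two] at h
  simp [blochMatrix] at h
  linarith

theorem eq_blochMatrix (ρ : DensityMatrix) :
    ρ.1 = blochMatrix (blochVector (2 * (ρ.1 0 0).re - 1) (2 * ρ.1 1 0)) := by
  have hh : ρ.1.IsHermitian := ρ.2.1.1
  have h01 : ρ.1 0 1 = star (ρ.1 1 0) := (hh.apply 0 1).symm
  have h00 : (ρ.1 0 0).im = 0 := by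
    have := congrArg Complex.im (hh.apply 0 0)
    simp at this
    linarith
  have htr : ρ.1 1 1 = 1 - ρ.1 0 0 := by
    have := ρ.2.2
    rw [Matrix.trace_fin_two] at this
    linear_combination this
  ext i j
  fin_cases i <;> fin_cases j <;> apply Complex.ext <;>
    simp [blochMatrix, blochVector, h01, htr, h00]
  ring

theorem normSq_eq_of_isPure {ρ : DensityMatrix} (hρ : IsPure ρ) :
    Complex.normSq (2 * ρ.1 1 0) = 1 - (2 * (ρ.1 0 0).re - 1) ^ 2 := by
  obtain ⟨ξ, hξ⟩ := hρ
  have htr := congrArg Complex.re ρ.2.2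
  rw [Matrix.trace_fin_two, hξ] at htr
  simp [Matrix.vecMulVec_apply] at htr
  rw [hξ]
  simp [Matrix.vecMulVec_apply, Complex.normSq_apply]
  linear_combination 4 * ((ξ 0).re * (ξ 0).re + (ξ 0).im * (ξ 0).im) * htr

/-- The pure state with polar coordinate `z` and phase `θ`. -/
def pureDensity (z : ℝ) (hz : z ^ 2 ≤ 1) (θ : ℝ) : DensityMatrix :=
  ⟨Matrix.vecMulVec ![(√((1 + z) / 2) : ℂ), √((1 - z) / 2) * Complex.exp (θ * Complex.I)]
      (star ![(√((1 + z) / 2) : ℂ), √((1 - z) / 2) * Complex.exp (θ * Complex.I)]),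
    Matrix.posSemidef_vecMulVec_self_star _, by
      obtain ⟨hz1, hz2⟩ := abs_le.1 ((sq_le_one_iff_abs_le_one z).1 hz)
      have h0 : √((1 + z) / 2) * √((1 + z) / 2) = (1 + z) / 2 := Real.mul_self_sqrt (by linarith)
      have h1 : √((1 - z) / 2) * √((1 - z) / 2) = (1 - z) / 2 := Real.mul_self_sqrt (by linarith)
      rw [Matrix.trace_fin_two]
      generalize √((1 + z) / 2) = k₀ at h0 ⊢
      generalize √((1 - z) / 2) = k₁ at h1 ⊢
      apply Complex.ext
      · simp [Matrix.vecMulVec_apply, Complex.exp_ofReal_mul_I_re, Complex.exp_ofReal_mul_I_im]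
        linear_combination h0 + h1 + k₁ ^ 2 * Real.cos_sq_add_sin_sq θ
      · simp [Matrix.vecMulVec_apply, Complex.exp_ofReal_mul_I_re, Complex.exp_ofReal_mul_I_im]
        ring⟩

theorem pureDensity_eq_blochMatrix (z : ℝ) (hz : z ^ 2 ≤ 1) (θ : ℝ) :
    (pureDensity z hz θ).1 =
      blochMatrix (blochVector z (√(1 - z ^ 2) * Complex.exp (θ * Complex.I))) := by
  obtain ⟨hz1, hz2⟩ := abs_le.1 ((sq_le_one_iff_abs_le_one z).1 hz)
  have h0 : √((1 + z) / 2) * √((1 + z) / 2) = (1 + z) / 2 := Real.mul_self_sqrt (by linarith)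
  have hN : √(1 - z ^ 2) = 2 * (√((1 + z) / 2) * √((1 - z) / 2)) := by
    rw [← Real.sqrt_mul (by linarith), show (1 - z ^ 2) = 2 ^ 2 * ((1 + z) / 2 * ((1 - z) / 2)) by
      ring, Real.sqrt_mul (by norm_num), Real.sqrt_sq (by norm_num)]
  have h00 : (pureDensity z hz θ).1 0 0 = √((1 + z) / 2) * star (√((1 + z) / 2) : ℂ) := rfl
  have h10 : (pureDensity z hz θ).1 1 0 =
    √((1 - z) / 2) * Complex.exp (θ * Complex.I) * star (√((1 + z) / 2) : ℂ) := rfl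
  rw [eq_blochMatrix (pureDensity z hz θ), h00, h10, hN, Complex.star_def, Complex.conj_ofReal,
    ← Complex.ofReal_mul, h0, Complex.ofReal_re]
  congr 2
  · ring
  · push_cast
    ring

theorem continuous_pureDensity (z : ℝ) (hz : z ^ 2 ≤ 1) : Continuous (pureDensity z hz) := by
  refine Continuous.subtype_mk ?_ _
  refine Continuous.matrix_vecMulVec ?_ (Continuous.star ?_) <;>
  · refine continuous_pi fun i => ?_
    fin_cases i
    · exact continuous_const
    · exact continuous_const.mul (Complex.continuous_exp.comp
        (Complex.continuous_ofReal.mul continuous_const))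

theorem precedes_iff_blochValue {d₁ d₂ : ℝ} {p q : Minkowski} {ρ σ : DensityMatrix}
    {r s : EuclideanSpace ℝ (Fin 3)} (hρ : ρ.1 = blochMatrix r) (hσ : σ.1 = blochMatrix s) :
    (productState p ρ).Precedes d₁ d₂ (productState q σ) ↔ ∀ a ∈ causalCone d₁ d₂,
      blochValue (a.1 p) (r 2) (r 0 + r 1 * Complex.I) ≤
        blochValue (a.1 q) (s 2) (s 0 + s 1 * Complex.I) :=
  forall₂_congr fun a ha => by
    rw [productState_re hρ p (ha.1 p), productState_re hσ q (ha.1 q)]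

theorem precedes_iff_of_blochVector {d₁ d₂ : ℝ} {p q : Minkowski} {ρ σ : DensityMatrix}
    {z z' : ℝ} {c c' : ℂ} (hρ : ρ.1 = blochMatrix (blochVector z c))
    (hσ : σ.1 = blochMatrix (blochVector z' c')) :
    (productState p ρ).Precedes d₁ d₂ (productState q σ) ↔ ∀ a ∈ causalCone d₁ d₂,
      blochValue (a.1 p) z c ≤ blochValue (a.1 q) z' c' := by
  rw [precedes_iff_blochValue hρ hσ]
  simp [blochVector, Complex.re_add_im]

/-! ### The causal relation between product states -/

/-- The opposite axis, `θ + π`, replaces each arccosine by its supplement, which turns the one-sided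
bound into a two-sided one. -/
theorem abs_arccos_sub_le_of_blochValue_le {d₁ d₂ : ℝ} {p q : Minkowski} {z : ℝ}
    (hz : z ^ 2 < 1) {r s θr θs : ℝ} (hr : 0 ≤ r) (hr1 : r ≤ 1) (hs : 0 ≤ s) (hs1 : s ≤ 1)
    (h : ∀ a ∈ causalCone d₁ d₂,
      blochValue (a.1 p) z (√(1 - z ^ 2) * (r * Complex.exp (θr * Complex.I))) ≤
        blochValue (a.1 q) z (√(1 - z ^ 2) * (s * Complex.exp (θs * Complex.I)))) (θ : ℝ) :
    |Real.arccos (s * Real.cos (θs + θ)) - Real.arccos (r * Real.cos (θr + θ))| ≤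
      √((q.1 - p.1 + (q.2 - p.2)) * (q.1 - p.1 - (q.2 - p.2))) * |d₁ - d₂| := by
  have hre : ∀ r ϑ θ : ℝ,
      (r * Complex.exp (ϑ * Complex.I) * Complex.exp (θ * Complex.I)).re =
        r * Real.cos (ϑ + θ) := fun r ϑ θ => by
    rw [mul_assoc, ← Complex.exp_add, ← add_mul, ← Complex.ofReal_add, Complex.re_ofReal_mul,
      Complex.exp_ofReal_mul_I_re]
  have habs : ∀ r ϑ : ℝ, 0 ≤ r → r ≤ 1 → |r * Real.cos ϑ| ≤ 1 := fun r ϑ h0 h1 => by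
    rw [abs_mul, abs_of_nonneg h0]
    exact mul_le_one₀ h1 (abs_nonneg _) (Real.abs_cos_le_one _)
  have key : ∀ θ : ℝ, Real.arccos (r * Real.cos (θr + θ)) ≤ Real.arccos (s * Real.cos (θs + θ)) +
      |d₁ - d₂| * √((q.1 - p.1 + (q.2 - p.2)) * (q.1 - p.1 - (q.2 - p.2))) := fun θ => by
    have := arccos_le_of_blochValue_le hz h (e := Complex.exp (θ * Complex.I))
      (Complex.norm_exp_ofReal_mul_I θ) (by rw [hre]; exact habs r _ hr hr1)
      (by rw [hre]; exact habs s _ hs hs1)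
    rwa [hre, hre] at this
  have h1 := key θ
  have h2 := key (θ + Real.pi)
  rw [← add_assoc, ← add_assoc, Real.cos_add_pi, Real.cos_add_pi, mul_neg, mul_neg,
    Real.arccos_neg, Real.arccos_neg] at h2
  rw [abs_le, mul_comm]
  constructor <;> linarith

theorem bddAbove_arccos_sub (f g : ℝ → ℝ) :
    BddAbove (Set.range fun θ => |Real.arccos (f θ) - Real.arccos (g θ)|) := by
  refine ⟨Real.pi, ?_⟩
  rintro _ ⟨θ, rfl⟩
  rw [abs_le]
  constructor <;> linarith [Real.arccos_nonneg (f θ), Real.arccos_le_pi (f θ),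
    Real.arccos_nonneg (g θ), Real.arccos_le_pi (g θ)]

/-- At the poles the radius vanishes, so the convention `r' / 0 = 0` agrees with reading the
quotient as `0`. -/
theorem polar_eq_sqrt_mul {r₀ r₁ r' θ z : ℝ} (hr' : 0 ≤ r') (h0 : r₀ = r' * Real.cos θ)
    (h1 : r₁ = r' * Real.sin θ) (h : r₀ ^ 2 + r₁ ^ 2 ≤ 1 - z ^ 2) :
    0 ≤ r' / √(1 - z ^ 2) ∧ r' / √(1 - z ^ 2) ≤ 1 ∧ (r₀ : ℂ) + r₁ * Complex.I =
      √(1 - z ^ 2) * ((r' / √(1 - z ^ 2) : ℝ) * Complex.exp (θ * Complex.I)) := by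
  have hsq : r' ^ 2 ≤ 1 - z ^ 2 := by
    refine le_trans (le_of_eq ?_) h
    rw [h0, h1]
    linear_combination -r' ^ 2 * Real.sin_sq_add_cos_sq θ
  have hle : r' ≤ √(1 - z ^ 2) := Real.le_sqrt_of_sq_le hsq
  refine ⟨by positivity, div_le_one_of_le₀ hle (Real.sqrt_nonneg _), ?_⟩
  have hmul : √(1 - z ^ 2) * (r' / √(1 - z ^ 2)) = r' := by
    rcases (Real.sqrt_nonneg (1 - z ^ 2)).eq_or_lt with hN | hN
    · rw [← hN] at hle ⊢
      rw [zero_mul]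
      linarith
    · exact mul_div_cancel₀ _ hN.ne'
  rw [← mul_assoc, ← Complex.ofReal_mul, hmul, h0, h1, Complex.exp_mul_I]
  push_cast
  ring

theorem precedes_iff_exists_causalCurve {d₁ d₂ : ℝ} {p q : Minkowski} {ρ σ : DensityMatrix}
    {r s : EuclideanSpace ℝ (Fin 3)} {r' θr s' θs : ℝ}
    (hρ : ρ.1 = blochMatrix r) (hσ : σ.1 = blochMatrix s)
    (hr' : 0 ≤ r') (hr0 : r 0 = r' * Real.cos θr) (hr1 : r 1 = r' * Real.sin θr)
    (hs' : 0 ≤ s') (hs0 : s 0 = s' * Real.cos θs) (hs1 : s 1 = s' * Real.sin θs) :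
    (productState p ρ).Precedes d₁ d₂ (productState q σ) ↔
      Precedes p q ∧ r 2 = s 2 ∧
      ∃ (γ : ℝ → Minkowski) (T : ℝ), IsCausalCurve γ T ∧ γ 0 = p ∧ γ T = q ∧
        properTime γ T * |d₁ - d₂| ≥
          ⨆ θ : ℝ, |Real.arccos (s' / √(1 - r 2 ^ 2) * Real.cos (θs + θ)) -
            Real.arccos (r' / √(1 - r 2 ^ 2) * Real.cos (θr + θ))| := by
  have hrle := sq_add_sq_le_of_eq_blochMatrix hρ
  have hsle := sq_add_sq_le_of_eq_blochMatrix hσ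
  have hz : r 2 ^ 2 ≤ 1 := by linarith [sq_nonneg (r 0), sq_nonneg (r 1)]
  rw [precedes_iff_blochValue hρ hσ]
  constructor
  · intro h
    have hzeq := eq_of_blochValue_le h
    obtain ⟨hu, hv⟩ := lightCone_of_blochValue_le h
    obtain ⟨γ, T, hγ, hγ0, hγT, hl⟩ := exists_straight_causalCurve hu hv
    refine ⟨⟨γ, T, hγ, hγ0, hγT⟩, hzeq, γ, T, hγ, hγ0, hγT, ciSup_le fun θ => ?_⟩
    rcases hz.eq_or_lt with hz1 | hz1
    · rw [hz1]
      simpa using mul_nonneg (properTime_nonneg hγ) (abs_nonneg (d₁ - d₂))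
    · rw [← hzeq] at hsle h
      obtain ⟨a1, a2, a3⟩ := polar_eq_sqrt_mul hr' hr0 hr1 hrle
      obtain ⟨b1, b2, b3⟩ := polar_eq_sqrt_mul hs' hs0 hs1 hsle
      rw [hl]
      refine abs_arccos_sub_le_of_blochValue_le hz1 a1 a2 b1 b2 ?_ θ
      rwa [← a3, ← b3]
  · rintro ⟨-, hzeq, γ, T, hγ, rfl, rfl, hsup⟩ a ha
    rw [← hzeq] at hsle ⊢
    obtain ⟨a1, a2, a3⟩ := polar_eq_sqrt_mul hr' hr0 hr1 hrle
    obtain ⟨b1, b2, b3⟩ := polar_eq_sqrt_mul hs' hs0 hs1 hsle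
    rw [a3, b3]
    exact blochValue_le_of_arccos ha hγ hz a1 a2 b1 b2 fun θ =>
      (le_ciSup (bddAbove_arccos_sub (fun θ => s' / √(1 - r 2 ^ 2) * Real.cos (θs + θ))
        fun θ => r' / √(1 - r 2 ^ 2) * Real.cos (θr + θ)) θ).trans hsup

/-! ### Causal paths of mixed states -/

/-- A phase difference is needed only modulo `2π`; the representative chosen has least absolute
value. -/
theorem exists_abs_eq_arccos_cos (x : ℝ) :
    ∃ y : ℝ, |y| = Real.arccos (Real.cos x) ∧
      Complex.exp (y * Complex.I) = Complex.exp (x * Complex.I) := by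
  have hcos : Real.cos (Real.arccos (Real.cos x)) = Real.cos x :=
    Real.cos_arccos (Real.neg_one_le_cos x) (Real.cos_le_one x)
  obtain ⟨k, hk⟩ := Real.cos_eq_cos_iff.1 hcos
  have hexp : ∀ y : ℝ, x = 2 * k * Real.pi + y →
      Complex.exp (y * Complex.I) = Complex.exp (x * Complex.I) := fun y hy => by
    rw [Complex.exp_eq_exp_iff_exists_int]
    refine ⟨-k, ?_⟩
    rw [hy]
    push_cast
    ring
  rcases hk with hk | hk
  · exact ⟨_, abs_of_nonneg (Real.arccos_nonneg _), hexp _ hk⟩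
  · exact ⟨-Real.arccos (Real.cos x), by rw [abs_neg, abs_of_nonneg (Real.arccos_nonneg _)],
      hexp _ (by linarith)⟩

/-- The increment bound uses the Lorentzian distance of two points of the curve. Divided by the
parameter difference, it tends to `D` times the speed, so an estimate of right slopes integrates to
the proper time of `γ`. No differentiability of `f` is needed. -/
theorem sub_le_properTime_of_causal {γ : ℝ → Minkowski} {T D : ℝ} (hγ : IsCausalCurve γ T)
    (hT : 0 < T) {f : ℝ → ℝ} (hf : ContinuousOn f (Set.Icc 0 T))
    (h : ∀ t ∈ Set.Icc 0 T, ∀ t' ∈ Set.Icc 0 T, t ≤ t' → f t' - f t ≤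
      D * √(((γ t').1 - (γ t).1 + ((γ t').2 - (γ t).2)) *
        ((γ t').1 - (γ t).1 - ((γ t').2 - (γ t).2)))) :
    f T - f 0 ≤ D * properTime γ T := by
  have hmain := image_le_of_liminf_slope_right_le_deriv_boundary (a := 0) (b := T)
    (f := fun t => f t - f 0) (B := fun t => D * elapsed γ T t)
    (B' := fun t => D * √(-metric (velocity γ T t) (velocity γ T t)))
    (hf.sub continuousOn_const) (by simp [elapsed_zero])
    ((continuousOn_elapsed hγ hT).const_mul D)
    (fun t ht => (hasDerivWithinAt_elapsed hγ ht).const_mul D) ?_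
  · exact hmain ⟨hT.le, le_rfl⟩
  · intro t ht R hR
    have htI : t ∈ Set.Icc 0 T := ⟨ht.1, ht.2.le⟩
    have hmem : Set.Icc 0 T ∈ nhdsWithin t (Set.Ioi t) :=
      Filter.mem_of_superset (Ioo_mem_nhdsGT ht.2) fun u hu => ⟨ht.1.trans hu.1.le, hu.2.le⟩
    have hd : HasDerivWithinAt γ (velocity γ T t) (Set.Ioi t) t :=
      ((hγ.2.1.differentiableOn one_ne_zero t htI).hasDerivWithinAt).mono_of_mem_nhdsWithin hmem
    have hslope := (hasDerivWithinAt_iff_tendsto_slope' (lt_irrefl t)).1 hd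
    have hcont : Continuous fun v : Minkowski => D * √(-metric v v) := by
      unfold metric
      fun_prop
    have hlim := (hcont.tendsto (velocity γ T t)).comp hslope
    have hev := hlim.eventually (gt_mem_nhds hR)
    refine Filter.Eventually.frequently ?_
    filter_upwards [hev, hmem, self_mem_nhdsWithin] with u hu huI hut
    refine lt_of_le_of_lt ?_ hu
    have hut' : 0 < (u - t)⁻¹ := inv_pos.2 (sub_pos.2 hut)
    have hk := h t htI u huI (le_of_lt hut)
    have hmet : -metric (slope γ t u) (slope γ t u) = (u - t)⁻¹ ^ 2 *
        (((γ u).1 - (γ t).1 + ((γ u).2 - (γ t).2)) *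
          ((γ u).1 - (γ t).1 - ((γ u).2 - (γ t).2))) := by
      simp only [slope, metric, vsub_eq_sub, Prod.smul_fst, Prod.smul_snd, Prod.fst_sub,
        Prod.snd_sub, smul_eq_mul]
      ring
    simp only [Function.comp_apply]
    rw [hmet, Real.sqrt_mul (sq_nonneg _), Real.sqrt_sq hut'.le, slope, smul_eq_mul, vsub_eq_sub,
      sub_sub_sub_cancel_right]
    calc (u - t)⁻¹ * (f u - f t) ≤ _ := mul_le_mul_of_nonneg_left hk hut'.le
      _ = _ := by ring

theorem arccos_cos_sub_le_of_isCausalPath {d₁ d₂ : ℝ} {γ : ℝ → Minkowski} {T : ℝ}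
    (hγ : IsCausalCurve γ T) (hT : 0 < T) {z : ℝ} (hz : z ^ 2 < 1) {c : ℝ → ℂ}
    (hc : ContinuousOn c (Set.Icc 0 T))
    (hn : ∀ t ∈ Set.Icc 0 T, ‖c t‖ ≤ √(1 - z ^ 2))
    (h : ∀ t ∈ Set.Icc 0 T, ∀ t' ∈ Set.Icc 0 T, t ≤ t' → ∀ a ∈ causalCone d₁ d₂,
      blochValue (a.1 (γ t)) z (c t) ≤ blochValue (a.1 (γ t')) z (c t')) {α α' : ℝ}
    (h0 : c 0 = √(1 - z ^ 2) * Complex.exp (α * Complex.I))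
    (h1 : c T = √(1 - z ^ 2) * Complex.exp (α' * Complex.I)) :
    Real.arccos (Real.cos (α' - α)) ≤ |d₁ - d₂| * properTime γ T := by
  set N := √(1 - z ^ 2) with hN
  have hN0 : 0 < N := Real.sqrt_pos.2 (by linarith)
  have hNc : (N : ℂ) ≠ 0 := Complex.ofReal_ne_zero.2 hN0.ne'
  -- This axis puts the initial state at projection `-1`, where the arccosine is `π`; its total
  -- decrease is then the full angle between the two end phases.
  set e := Complex.exp ((Real.pi - α : ℝ) * Complex.I) with he
  have he1 : ‖e‖ = 1 := Complex.norm_exp_ofReal_mul_I _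
  have hcw : ∀ t, c t = N * (c t / N) := fun t => (mul_div_cancel₀ _ hNc).symm
  have hle : ∀ t ∈ Set.Icc 0 T, |(c t / N * e).re| ≤ 1 := fun t ht => by
    refine (Complex.abs_re_le_norm _).trans ?_
    rw [norm_mul, he1, mul_one, norm_div, Complex.norm_real, Real.norm_eq_abs, abs_of_pos hN0]
    exact div_le_one_of_le₀ (hn t ht) hN0.le
  have hcont : ContinuousOn (fun t => -Real.arccos (c t / N * e).re) (Set.Icc 0 T) := by
    refine ContinuousOn.neg (Real.continuous_arccos.comp_continuousOn ?_)
    exact Complex.continuous_re.comp_continuousOn ((hc.div_const _).mul continuousOn_const)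
  have hmain := sub_le_properTime_of_causal hγ hT (D := |d₁ - d₂|) hcont
    fun t ht t' ht' htt' => by
      have hab := h t ht t' ht' htt'
      rw [hcw t, hcw t'] at hab
      have := arccos_le_of_blochValue_le hz hab he1 (hle t ht) (hle t' ht')
      linarith
  have hval : ∀ ϑ : ℝ, ((N : ℂ) * Complex.exp (ϑ * Complex.I) / N * e).re =
      -Real.cos (ϑ - α) := fun ϑ => by
    rw [mul_div_cancel_left₀ _ hNc, he, ← Complex.exp_add, ← add_mul, ← Complex.ofReal_add,
      Complex.exp_ofReal_mul_I_re, show ϑ + (Real.pi - α) = (ϑ - α) + Real.pi by ring,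
      Real.cos_add_pi]
  rw [h0, h1, hval, hval, Real.arccos_neg, Real.arccos_neg, sub_self, Real.cos_zero,
    Real.arccos_one] at hmain
  linarith

theorem exists_pure_causalPath {d₁ d₂ : ℝ} {γ : ℝ → Minkowski} {T : ℝ} {ρ : ℝ → DensityMatrix}
    (h : IsCausalPath d₁ d₂ γ T ρ) (h0 : IsPure (ρ 0)) (hT : IsPure (ρ T)) :
    ∃ ρ' : ℝ → DensityMatrix, IsCausalPath d₁ d₂ γ T ρ' ∧
      (∀ t ∈ Set.Icc 0 T, IsPure (ρ' t)) ∧ ρ' 0 = ρ 0 ∧ ρ' T = ρ T := by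
  obtain ⟨hγ, hρc, hprec⟩ := h
  rcases hγ.1.eq_or_lt with rfl | hTpos
  · refine ⟨ρ, ⟨hγ, hρc, hprec⟩, fun t ht => ?_, rfl, rfl⟩
    rw [Set.Icc_self] at ht
    rwa [ht]
  have m0 : (0 : ℝ) ∈ Set.Icc 0 T := ⟨le_rfl, hTpos.le⟩
  have mT : T ∈ Set.Icc 0 T := ⟨hTpos.le, le_rfl⟩
  set c : ℝ → ℂ := fun t => 2 * (ρ t).1 1 0 with hc
  set z : ℝ := 2 * ((ρ 0).1 0 0).re - 1 with hz
  -- Causality fixes the latitude along the whole path, so both pure ends lie on one circle.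
  have hzt : ∀ t ∈ Set.Icc 0 T, 2 * ((ρ t).1 0 0).re - 1 = z := fun t ht =>
    (eq_of_blochValue_le ((precedes_iff_of_blochVector (eq_blochMatrix (ρ 0))
      (eq_blochMatrix (ρ t))).1 (hprec 0 m0 t ht ht.1))).symm
  have hρt : ∀ t ∈ Set.Icc 0 T, (ρ t).1 = blochMatrix (blochVector z (c t)) := fun t ht => by
    rw [← hzt t ht]
    exact eq_blochMatrix (ρ t)
  have hnorm : ∀ t ∈ Set.Icc 0 T, ‖c t‖ ^ 2 ≤ 1 - z ^ 2 := fun t ht => by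
    have := sq_add_sq_le_of_eq_blochMatrix (hρt t ht)
    rw [Complex.sq_norm, Complex.normSq_apply]
    simp only [blochVector] at this
    simpa [pow_two] using this
  have hz1 : z ^ 2 ≤ 1 := by linarith [hnorm 0 m0, sq_nonneg ‖c 0‖]
  have hn : ∀ t ∈ Set.Icc 0 T, ‖c t‖ ≤ √(1 - z ^ 2) := fun t ht =>
    Real.le_sqrt_of_sq_le (hnorm t ht)
  have hpolar : ∀ t ∈ Set.Icc 0 T, IsPure (ρ t) →
      c t = √(1 - z ^ 2) * Complex.exp (Complex.arg (c t) * Complex.I) := fun t ht hp => by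
    have := normSq_eq_of_isPure hp
    rw [hzt t ht, Complex.normSq_eq_norm_sq] at this
    rw [← this, Real.sqrt_sq (norm_nonneg _), Complex.norm_mul_exp_arg_mul_I]
  have hbl : ∀ t ∈ Set.Icc 0 T, ∀ t' ∈ Set.Icc 0 T, t ≤ t' → ∀ a ∈ causalCone d₁ d₂,
      blochValue (a.1 (γ t)) z (c t) ≤ blochValue (a.1 (γ t')) z (c t') :=
    fun t ht t' ht' htt' =>
      (precedes_iff_of_blochVector (hρt t ht) (hρt t' ht')).1 (hprec t ht t' ht' htt')
  have hcc : ContinuousOn c (Set.Icc 0 T) := by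
    have hcoe : Continuous fun σ : DensityMatrix => 2 * σ.1 1 0 :=
      continuous_const.mul (continuous_subtype_val.matrix_elem 1 0)
    exact hcoe.comp_continuousOn hρc
  set α := Complex.arg (c 0)
  set α' := Complex.arg (c T)
  have hl := properTime_nonneg hγ
  obtain ⟨δ, hδ, hδc⟩ : ∃ δ : ℝ, |δ| ≤ |d₁ - d₂| * properTime γ T ∧
      c T = √(1 - z ^ 2) * Complex.exp ((α + δ : ℝ) * Complex.I) := by
    -- At a pole the circle is a point and no rotation is needed.
    rcases hz1.eq_or_lt with hz2 | hz2
    · refine ⟨0, by simpa using mul_nonneg (abs_nonneg (d₁ - d₂)) hl, ?_⟩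
      rw [hpolar T mT hT, hz2]
      simp
    · obtain ⟨δ, h1, h2⟩ := exists_abs_eq_arccos_cos (α' - α)
      refine ⟨δ, h1 ▸ arccos_cos_sub_le_of_isCausalPath hγ hTpos hz2 hcc hn hbl
        (hpolar 0 m0 h0) (hpolar T mT hT), ?_⟩
      rw [Complex.ofReal_add, add_mul, Complex.exp_add, h2, ← Complex.exp_add, ← add_mul,
        ← Complex.ofReal_add, add_sub_cancel]
      exact hpolar T mT hT
  have hkey : |δ / properTime γ T| ≤ |d₁ - d₂| ∧
      δ / properTime γ T * properTime γ T = δ := by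
    rcases hl.eq_or_lt with hl0 | hl0
    · rw [← hl0, mul_zero] at hδ
      rw [abs_nonpos_iff.1 hδ]
      simp
    · exact ⟨by rwa [abs_div, abs_of_pos hl0, div_le_iff₀ hl0], div_mul_cancel₀ _ hl0.ne'⟩
  set κ := δ / properTime γ T
  refine ⟨fun t => pureDensity z hz1 (α + κ * elapsed γ T t), ⟨hγ, ?_, ?_⟩, ?_, ?_, ?_⟩
  · exact (continuous_pureDensity z hz1).comp_continuousOn
      (((continuousOn_elapsed hγ hTpos).const_mul κ).const_add α)
  · intro t ht t' ht' htt'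
    rw [precedes_iff_of_blochVector (pureDensity_eq_blochMatrix _ _ _)
      (pureDensity_eq_blochMatrix _ _ _)]
    exact fun a ha => monotoneOn_transport ha hγ hz1 α hkey.1 ht ht' htt'
  · exact fun t _ => ⟨_, rfl⟩
  · refine Subtype.ext ?_
    rw [pureDensity_eq_blochMatrix, hρt 0 m0, elapsed_zero, mul_zero, add_zero]
    exact congrArg (fun c => blochMatrix (blochVector z c)) (hpolar 0 m0 h0).symm
  · refine Subtype.ext ?_
    rw [pureDensity_eq_blochMatrix, hρt T mT, show elapsed γ T T = properTime γ T from rfl, hkey.2]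
    exact congrArg (fun c => blochMatrix (blochVector z c)) hδc.symm

end AlmostCommutative

end

theorem theorem3p12 (d₁ d₂ : ℝ) :
    (∀ (p q : Minkowski) (ρ σ : DensityMatrix) (r s : EuclideanSpace ℝ (Fin 3))
        (r' θr s' θs : ℝ),
      ρ.1 = blochMatrix r → σ.1 = blochMatrix s →
      0 ≤ r' → r 0 = r' * Real.cos θr → r 1 = r' * Real.sin θr →
      0 ≤ s' → s 0 = s' * Real.cos θs → s 1 = s' * Real.sin θs →
      ((productState p ρ).Precedes d₁ d₂ (productState q σ) ↔
        Precedes p q ∧ r 2 = s 2 ∧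
        ∃ (γ : ℝ → Minkowski) (T : ℝ), IsCausalCurve γ T ∧ γ 0 = p ∧ γ T = q ∧
          properTime γ T * |d₁ - d₂| ≥
            ⨆ θ : ℝ, |Real.arccos (s' / √(1 - r 2 ^ 2) * Real.cos (θs + θ)) -
              Real.arccos (r' / √(1 - r 2 ^ 2) * Real.cos (θr + θ))|)) ∧
    (∀ (γ : ℝ → Minkowski) (T : ℝ) (ρ : ℝ → DensityMatrix),
      IsCausalPath d₁ d₂ γ T ρ → IsPure (ρ 0) → IsPure (ρ T) →
      ∃ ρ' : ℝ → DensityMatrix, IsCausalPath d₁ d₂ γ T ρ' ∧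
        (∀ t ∈ Set.Icc 0 T, IsPure (ρ' t)) ∧ ρ' 0 = ρ 0 ∧ ρ' T = ρ T) := by
  exact ⟨fun _ _ _ _ _ _ _ _ _ _ hρ hσ hr' hr0 hr1 hs' hs0 hs1 =>
      precedes_iff_exists_causalCurve hρ hσ hr' hr0 hr1 hs' hs0 hs1,
    fun _ _ _ h h0 hT => exists_pure_causalPath h h0 hT⟩
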